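/- Let $\mathcal G$ be a connected, locally finite, possibly infinite metric graph with vertex set $\mathsf V$, edge set $\mathsf E$ and edge lengths $\ell_{\mathsf e}\in(0,\infty)$ such that $\inf_{\mathsf e\in\mathsf E}\ell_{\mathsf e}>0$ (loops and multiple edges are allowed), endowed with the shortest path metric $d_{\mathcal G}$ and with the direct sum of the Lebesgue measures on the edges; let $\mathcal E=\bigsqcup_{\mathsf e\in\mathsf E}(0,\ell_{\mathsf e})$. Let $W^{1,2}(\mathcal G)$ be the space of continuous $f\in L^2(\mathcal G)$ that have an edgewise weak derivative $f'\in L^2(\mathcal G)$, let $\mathsf V_{\mathsf D}\subset\mathsf V$ be arbitrary, and let $\Delta$ be the Laplacian on $L^2(\mathcal G)$ (complex-valued functions) with Dirichlet conditions at $\mathsf V_{\mathsf D}$ and standard (continuity/Kirchhoff) conditions at $\mathsf V\setminus\mathsf V_{\mathsf D}$: $u\in D(\Delta)$ and $\Delta u=w$ if and only if $u$ belongs to $W^{1,2}_0(\mathcal G;\mathsf V_{\mathsf D})=\{f\in W^{1,2}(\mathcal G): f|_{\mathsf V_{\mathsf D}}=0\}$, $w\in L^2(\mathcal G)$, and $\int_{\mathcal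 G}u'\overline{h'}=-\int_{\mathcal G}w\overline h$ for all $h\in W^{1,2}_0(\mathcal G;\mathsf V_{\mathsf D})$. Then the strongly continuous semigroup $(\mathrm e^{t\Delta})_{t\ge0}$ generated by $\Delta$ has a heat kernel $p=p_t(x,y)$, that is: for $t>0$ the function $p_t$ is measurable on $\mathcal G\times\mathcal G$ and is an integral kernel of $\mathrm e^{t\Delta}$; for a.e. $y$ the map $t\mapsto p_t(\cdot,y)$ is in $C^1((0,\infty);L^2(\mathcal G))\cap C((0,\infty);D(\Delta))$ and solves $\partial_tp_t(\cdot,y)=\Delta_xp_t(\cdot,y)$ for $t>0$; and $p_{t+s}(x,y)=\int_{\mathcal G}p_t(x,z)p_s(z,y)\,\mathrm dz$ for all $s,t>0$ and a.e. $(x,y)$. For each $t>0$, $p_t$ is unique up to null sets, and $p$ can be chosen such that the following holds. (i) For every $t>0$ and $x\in\mathcal G$, $p_t(x,\cdot)\in D(\Delta)$ and $\Delta_yp_t(x,\cdot)\in L^2(\mathcal G)\cap L^\infty(\mathcal G)$; and for every $t>0$ the map $x\mapsto\Delta_yp_t(x,\cdot)$ is Lipschitz continuous from $\mathcal G$ to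 $L^2(\mathcal G)$ and to $L^\infty(\mathcal G)$. (ii) For every $t>0$, $p_t$ is Lipschitz continuous on $\mathcal G\times\mathcal G$ with respect to the sum metric; the classical derivative $\frac{\partial^2}{\partial x^2}\frac{\partial^2}{\partial y^2}p_t$ exists on $\mathcal E\times\mathcal E$ and extends to a Lipschitz continuous function on $\mathcal G\times\mathcal G$. (iii) $p_t(x,\cdot)\in W^{2,2}(\mathcal E)\cap W^{1,2}(\mathcal G)$ for all $t>0$ and $x\in\mathcal G$, and there are constants $C_1,C_2>0$ such that \[ \|p_t(x,\cdot)-p_t(x',\cdot)\|_{W^{2,2}(\mathcal E)}\le(C_1+C_2t^{-2})\,d_{\mathcal G}(x,x')\qquad\text{for all }t>0,\ x,x'\in\mathcal G, \] where $\|f\|_{W^{2,2}(\mathcal E)}^2=\|f\|_{L^2}^2+\|f'\|_{L^2}^2+\|f''\|_{L^2}^2$. In particular $x\mapsto p_t(x,\cdot)$ is Lipschitz continuous into this space for every $t>0$. -/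

import Mathlib

open MeasureTheory Filter Set Topology
open scoped ENNReal NNReal ContDiff ComplexConjugate

noncomputable section

/-- A metric graph with vertex set `V` and edge set `E`: the edge `e` is an interval of length
`len e ∈ (0, ∞)` whose endpoints are glued to the vertices `src e` (coordinate `0`) and `tgt e`
(coordinate `len e`). Loops and multiple edges are allowed, `V` and `E` may be infinite. -/
structure MetricGraph (V E : Type*) where
  src : E → V
  tgt : E → V
  len : E → ℝ
  len_pos : ∀ e, 0 < len e

namespace MetricGraph

variable {V E : Type*}

/-- The points of the metric graph: the vertices and the interior points of the edges. -/
inductive Point (G : MetricGraph V E)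
  | vertex (v : V) : Point G
  | inner (e : E) (s : ℝ) (h₀ : 0 < s) (h₁ : s < G.len e) : Point G

/-- The point with coordinate `s ∈ [0, len e]` on the closed edge `e`
(coordinates outside this interval are moved to the nearest endpoint). -/
def pt (G : MetricGraph V E) (e : E) (s : ℝ) : G.Point :=
  if h₀ : 0 < s then
    if h₁ : s < G.len e then Point.inner e s h₀ h₁ else Point.vertex (G.tgt e)
  else Point.vertex (G.src e)

/-- Every vertex has finitely many incident edges. -/
def LocallyFinite (G : MetricGraph V E) : Prop :=
  ∀ v, {e | G.src e = v ∨ G.tgt e = v}.Finite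

/-- The underlying combinatorial graph is connected. -/
def IsConnected (G : MetricGraph V E) : Prop :=
  (SimpleGraph.fromRel fun u v => ∃ e, G.src e = u ∧ G.tgt e = v).Connected

/-- The edge lengths are bounded away from zero. -/
def LengthsBoundedBelow (G : MetricGraph V E) : Prop :=
  ∃ c : ℝ, 0 < c ∧ ∀ e, c ≤ G.len e

/-- `G.PathLength x y L`: some finite path of segments of edges from `x` to `y` has length `L`. -/
inductive PathLength (G : MetricGraph V E) : G.Point → G.Point → ℝ≥0 → Prop
  | nil (x : G.Point) : PathLength G x x 0
  | cons (e : E) (s t : ℝ) (hs : s ∈ Icc 0 (G.len e)) (ht : t ∈ Icc 0 (G.len e))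
      (y : G.Point) (L : ℝ≥0) (h : PathLength G (G.pt e t) y L) :
      PathLength G (G.pt e s) y (nndist s t + L)

theorem PathLength.append {G : MetricGraph V E} {x y z : G.Point} {L M : ℝ≥0}
    (h : G.PathLength x y L) (h' : G.PathLength y z M) : G.PathLength x z (L + M) := by
  induction h with
  | nil x => simpa using h'
  | cons e s t hs ht y L _ ih =>
    rw [add_assoc]
    exact PathLength.cons e s t hs ht _ _ (ih h')

theorem PathLength.symm {G : MetricGraph V E} {x y : G.Point} {L : ℝ≥0}
    (h : G.PathLength x y L) : G.PathLength y x L := by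
  induction h with
  | nil x => exact PathLength.nil x
  | cons e s t hs ht y L _ ih =>
    have h1 : G.PathLength (G.pt e t) (G.pt e s) (nndist t s + 0) :=
      PathLength.cons e t s ht hs _ _ (PathLength.nil _)
    have h2 := ih.append h1
    rwa [add_zero, nndist_comm t s, add_comm] at h2

/-- The shortest path metric (with value `∞` between different connected components). -/
instance (G : MetricGraph V E) : PseudoEMetricSpace G.Point where
  edist x y := ⨅ (L : ℝ≥0) (_ : G.PathLength x y L), (L : ℝ≥0∞)
  edist_self x := by
    refine le_antisymm ?_ bot_le
    exact (iInf₂_le (0 : ℝ≥0) (PathLength.nil x)).trans (by simp)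
  edist_comm x y := by
    refine le_antisymm ?_ ?_ <;>
      exact le_iInf₂ fun L h => iInf₂_le L h.symm
  edist_triangle x y z := by
    simp only [ENNReal.iInf_add, ENNReal.add_iInf]
    refine le_iInf₂ fun M h' => le_iInf₂ fun L h => ?_
    exact (iInf₂_le (L + M) (h.append h')).trans (by simp)

instance (G : MetricGraph V E) : MeasurableSpace G.Point := borel _

instance (G : MetricGraph V E) : BorelSpace G.Point := ⟨rfl⟩

/-- The shortest path metric as a real number. -/
def d (G : MetricGraph V E) (x y : G.Point) : ℝ := (edist x y).toReal

theorem pt_clamp (G : MetricGraph V E) (e : E) (s : ℝ) :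
    G.pt e s = G.pt e (max 0 (min s (G.len e))) := by
  have hl := G.len_pos e
  rcases le_or_gt s 0 with h | h
  · have : max 0 (min s (G.len e)) = 0 := max_eq_left ((min_le_left _ _).trans h)
    rw [this]; simp [pt, not_lt.2 h]
  · rcases le_or_gt (G.len e) s with h' | h'
    · rw [min_eq_right h', max_eq_right hl.le]; simp [pt, h, hl, not_lt.2 h']
    · rw [min_eq_left h'.le, max_eq_right h.le]

theorem lipschitzWith_pt (G : MetricGraph V E) (e : E) : LipschitzWith 1 (G.pt e) := by
  have hl := G.len_pos e
  have hc : LipschitzWith 1 (fun s : ℝ => max 0 (min s (G.len e))) :=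
    (LipschitzWith.id.min_const (G.len e)).const_max 0
  have hm : ∀ s : ℝ, max 0 (min s (G.len e)) ∈ Icc 0 (G.len e) := fun s =>
    ⟨le_max_left _ _, max_le hl.le (min_le_right _ _)⟩
  intro s t
  rw [pt_clamp G e s, pt_clamp G e t]
  refine le_trans ?_ (hc s t)
  rw [edist_nndist (max 0 (min s (G.len e)))]
  have h1 := PathLength.cons (G := G) e _ _ (hm s) (hm t) _ _ (PathLength.nil _)
  rw [add_zero] at h1
  exact iInf₂_le _ h1

theorem measurable_pt (G : MetricGraph V E) (e : E) : Measurable (G.pt e) :=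
  (G.lipschitzWith_pt e).continuous.measurable

/-- The canonical measure: the direct sum of the Lebesgue measures on the edges. -/
def vol (G : MetricGraph V E) : Measure G.Point :=
  Measure.sum fun e => (volume.restrict (Ioo 0 (G.len e))).map (G.pt e)

/-- The Hilbert space `L²(G)` of complex-valued functions. -/
abbrev L2 (G : MetricGraph V E) : Type _ := Lp ℂ 2 G.vol

/-- `g` is, on every open edge, the weak derivative of `f`. -/
def IsWeakDeriv (G : MetricGraph V E) (f g : G.Point → ℂ) : Prop :=
  ∀ e, LocallyIntegrableOn (fun s => f (G.pt e s)) (Ioo 0 (G.len e)) ∧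
    LocallyIntegrableOn (fun s => g (G.pt e s)) (Ioo 0 (G.len e)) ∧
    ∀ φ : ℝ → ℂ, ContDiff ℝ ∞ φ → HasCompactSupport φ → tsupport φ ⊆ Ioo 0 (G.len e) →
      ∫ s in Ioo 0 (G.len e), f (G.pt e s) * deriv φ s =
        -∫ s in Ioo 0 (G.len e), g (G.pt e s) * φ s

/-- `f ∈ W^{1,2}(G)`, with derivative `f'`: edgewise in `W^{1,2}`, square integrable together with
its derivative over the whole graph, and continuous on `G`. -/
structure MemW12 (G : MetricGraph V E) (f f' : G.Point → ℂ) : Prop where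
  continuous : Continuous f
  memLp : MemLp f 2 G.vol
  memLp_deriv : MemLp f' 2 G.vol
  isWeakDeriv : G.IsWeakDeriv f f'

/-- `f ∈ W₀^{1,2}(G; D)`, with derivative `f'`: the functions in `W^{1,2}(G)` that vanish on the
set `D` of vertices. -/
structure MemFormDomain (G : MetricGraph V E) (D : Set V) (f f' : G.Point → ℂ) : Prop
    extends G.MemW12 f f' where
  dirichlet : ∀ v ∈ D, f (Point.vertex v) = 0

/-- (The class of) `f` is in the domain of the Laplacian `Δ` and `Δ f = g`, where `Δ` is the
operator in `L²(G)` associated with the quadratic form `f ↦ ‖f'‖²` with domain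
`W₀^{1,2}(G; D)`, that is `⟪f', h'⟫ = -⟪Δ f, h⟫` for all `h` in the form domain. -/
def IsLaplacian (G : MetricGraph V E) (D : Set V) (f g : G.Point → ℂ) : Prop :=
  MemLp g 2 G.vol ∧ ∃ f₀ f' : G.Point → ℂ, f =ᵐ[G.vol] f₀ ∧ G.MemFormDomain D f₀ f' ∧
    ∀ h h' : G.Point → ℂ, G.MemFormDomain D h h' →
      ∫ x, f' x * conj (h' x) ∂G.vol = -∫ x, g x * conj (h x) ∂G.vol

/-- `T`, restricted to `[0, ∞)`, is the strongly continuous semigroup generated by the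
Laplacian. -/
structure IsHeatSemigroup (G : MetricGraph V E) (D : Set V) (T : ℝ → G.L2 →L[ℂ] G.L2) :
    Prop where
  zero : T 0 = 1
  add : ∀ s t, 0 ≤ s → 0 ≤ t → T (s + t) = T s ∘L T t
  strongly_continuous : ∀ u, ContinuousOn (fun t => T t u) (Ici 0)
  generator : ∀ u w : G.L2, G.IsLaplacian D u w ↔
    Tendsto (fun t : ℝ => t⁻¹ • (T t u - u)) (𝓝[>] 0) (𝓝 w)

/-- `p` is a heat kernel of the Laplacian `Δ`: a family of measurable integral kernels of the
operators `e^{tΔ}`, `t > 0`, such that `t ↦ p t · y` is, for a.e. `y`, continuously differentiable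
with values in `L²(G)`, continuous with values in the domain of `Δ`, and solves the heat
equation, and such that the Chapman-Kolmogorov identity holds. -/
structure IsHeatKernel (G : MetricGraph V E) (D : Set V) (p : ℝ → G.Point → G.Point → ℂ) :
    Prop where
  measurable : ∀ t, 0 < t → Measurable (Function.uncurry (p t))
  kernel : ∃ T, G.IsHeatSemigroup D T ∧ ∀ t, 0 < t → ∀ u : G.L2, ∀ᵐ x ∂G.vol,
    Integrable (fun y => p t x y * u y) G.vol ∧ T t u x = ∫ y, p t x y * u y ∂G.vol
  heat_equation : ∀ᵐ y ∂G.vol, ∃ u w : ℝ → G.L2,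
    (∀ t, 0 < t → (fun x => p t x y) =ᵐ[G.vol] u t) ∧
    (∀ t, 0 < t → G.IsLaplacian D (u t) (w t)) ∧
    ContinuousOn w (Ioi 0) ∧ ∀ t, 0 < t → HasDerivAt u (w t) t
  chapman_kolmogorov : ∀ s t, 0 < s → 0 < t → ∀ᵐ z ∂(G.vol.prod G.vol),
    Integrable (fun y => p t z.1 y * p s y z.2) G.vol ∧
      p (t + s) z.1 z.2 = ∫ y, p t z.1 y * p s y z.2 ∂G.vol

/-- `g` is the classical derivative of `f` on every open edge. -/
def HasEdgeDeriv (G : MetricGraph V E) (f g : G.Point → ℂ) : Prop :=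
  ∀ e, ∀ s ∈ Ioo 0 (G.len e), HasDerivAt (fun s => f (G.pt e s)) (g (G.pt e s)) s

/-- `q` is, on the product of the open edges with themselves, the iterated classical partial
derivative `∂²/∂x² ∂²/∂y² k`; the values of `q` at the vertices are not restricted. -/
def IsMixedSecondDeriv (G : MetricGraph V E) (k q : G.Point → G.Point → ℂ) : Prop :=
  ∃ k₁ k₂ k₃ : G.Point → G.Point → ℂ,
    (∀ x, G.HasEdgeDeriv (k x) (k₁ x)) ∧ (∀ x, G.HasEdgeDeriv (k₁ x) (k₂ x)) ∧
    ∀ e, ∀ r ∈ Ioo 0 (G.len e),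
      G.HasEdgeDeriv (fun x => k₂ x (G.pt e r)) (fun x => k₃ x (G.pt e r)) ∧
      G.HasEdgeDeriv (fun x => k₃ x (G.pt e r)) (fun x => q x (G.pt e r))

/-- Lipschitz continuity on `G × G` with respect to the sum metric. -/
def JointlyLipschitz (G : MetricGraph V E) (k : G.Point → G.Point → ℂ) : Prop :=
  ∃ L : ℝ, ∀ x x' y y', ‖k x y - k x' y'‖ ≤ L * (G.d x x' + G.d y y')

/-- `f` belongs to `W^{2,2}` of the disjoint union of the open edges. -/
def MemW22 (G : MetricGraph V E) (f : G.Point → ℂ) : Prop :=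
  ∃ f' f'' : G.Point → ℂ, G.IsWeakDeriv f f' ∧ G.IsWeakDeriv f' f'' ∧
    MemLp f 2 G.vol ∧ MemLp f' 2 G.vol ∧ MemLp f'' 2 G.vol

/-- The norm `(‖f‖² + ‖f'‖² + ‖f''‖²)^{1/2}` of `W^{2,2}` of the disjoint union of the open edges.
Weak derivatives being unique up to null sets, the infimum is over one single value; it is `∞`
if `f` has no weak derivatives. -/
def w22Norm (G : MetricGraph V E) (f : G.Point → ℂ) : ℝ≥0∞ :=
  ⨅ (f' : G.Point → ℂ) (f'' : G.Point → ℂ) (_ : G.IsWeakDeriv f f') (_ : G.IsWeakDeriv f' f''),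
    (eLpNorm f 2 G.vol ^ 2 + eLpNorm f' 2 G.vol ^ 2 + eLpNorm f'' 2 G.vol ^ 2) ^ (1 / 2 : ℝ)

end MetricGraph

end

/-!
Let `R = (1 - Δ)⁻¹`. The heat kernel, together with all the kernels derived from it, is obtained by
putting a bounded function of `R` between two copies of `R`, each of which contributes one
smoothing step.

* *The resolvent.* By the Riesz representation theorem, the inclusion `J` of the form domain
  `W₀^{1,2}` (a Hilbert space with the `W^{1,2}` inner product) into `L²` yields `R = J J†`, which
  is a positive injective contraction, and `Δ u = w` holds if and only if `u = R (u - w)`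
  (`MetricGraph.IsResolventKernel.isLaplacian_iff`). Since the edge lengths are bounded below, the
  one-dimensional Sobolev inequality bounds the evaluation functionals `f ↦ f x` on the form
  domain uniformly in `x`, so that `(R v) x = ⟪r x, v⟫` for vectors `r x` in `L²`. As `(R v)'` and
  `(R v)'' = R v - v` are controlled by `v`, the derivative of `R v` is bounded by a multiple of
  `‖v‖`, and `x ↦ r x` is bounded and Lipschitz continuous
  (`MetricGraph.exists_isResolventKernel`).
* *The semigroup.* The operators `heatPower R n t = (1 - Δ)ⁿ exp (t Δ)`, `t > 0`, are defined by
  the continuous functional calculus of `R`, with the function `a ↦ a⁻ⁿ exp (t (1 - a⁻¹))`. They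
  are bounded and satisfy `R * heatPower R (n + 1) t = heatPower R n t` and
  `d/dt heatPower R n t = heatPower R n t - heatPower R (n + 1) t`. Those with `n = 0` form the
  semigroup of `Δ`, which is unique because `Δ` is dissipative.
* *The kernels.* From `exp (t Δ) = R (heatPower R 2 t) R` it follows that
  `p_t(x, y) = ⟪r x, heatPower R 2 t (r y)⟫`. Since `Δ R = R - 1`, applying `Δ` in one variable
  to `⟪r x, S (r y)⟫`, where `R S - S = R S'` and `S'` is bounded, gives `⟪r x, S' (r y)⟫`. So
  `Δ_y p_t` and `Δ_x Δ_y p_t` are of the same form, with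
  `heatPower R 2 t - heatPower R 3 t` and
  `heatPower R 2 t - 2 heatPower R 3 t + heatPower R 4 t` in the middle, and every such kernel is
  jointly Lipschitz continuous because `r` is. The `W^{2,2}` norm of `R v` is at most `‖v‖`, and
  `‖heatPower R 2 t‖ ≤ 2 + 4 t⁻²`, which gives the Lipschitz bound in `W^{2,2}`.
* *Uniqueness of the kernel.* The Borel sets of the graph are generated by a countable algebra, so
  two kernels of the same operator have the same integrals over almost all slices, hence agree
  almost everywhere.
-/

open scoped InnerProductSpace

/-! ### Semigroups obtained from a positive contraction by functional calculus -/

/-- The function `r ↦ r⁻ⁿ exp (t (1 - r⁻¹))` on `(0, ∞)`, extended by `0`. At `r = (1 + a)⁻¹` it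
takes the value `(1 + a)ⁿ exp (-t a)`. -/
noncomputable def expProfile (n : ℕ) (t r : ℝ) : ℝ :=
  if r ≤ 0 then 0 else (r ^ n)⁻¹ * Real.exp (t * (1 - r⁻¹))

theorem expProfile_of_pos (n : ℕ) (t : ℝ) {r : ℝ} (hr : 0 < r) :
    expProfile n t r = (r ^ n)⁻¹ * Real.exp (t * (1 - r⁻¹)) := if_neg hr.not_ge

theorem expProfile_of_nonpos (n : ℕ) (t : ℝ) {r : ℝ} (hr : r ≤ 0) : expProfile n t r = 0 :=
  if_pos hr

theorem continuous_expProfile (n : ℕ) {t : ℝ} (ht : 0 < t) : Continuous (expProfile n t) := by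
  have h := (expNegInvGlue.continuous_polynomial_eval_inv_mul (Polynomial.X ^ n)).comp
    (continuous_id.div_const t)
  have h2 := h.const_mul (Real.exp t * (t ^ n)⁻¹)
  refine h2.congr fun r => ?_
  rcases le_or_gt r 0 with hr | hr
  · simp [expProfile_of_nonpos n t hr, expNegInvGlue.zero_of_nonpos (div_nonpos_of_nonpos_of_nonneg hr ht.le)]
  · have : expNegInvGlue (r / t) = Real.exp (-(r / t)⁻¹) := if_neg (div_pos hr ht).not_ge
    rw [expProfile_of_pos n t hr]
    simp only [Function.comp, id, this, Polynomial.eval_pow, Polynomial.eval_X]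
    rw [mul_sub, mul_one, sub_eq_add_neg, Real.exp_add]
    have : (r / t)⁻¹ = t * r⁻¹ := by field_simp
    rw [this, mul_pow]
    have := (pow_pos ht n).ne'
    rw [inv_pow]
    field_simp

theorem expProfile_mul (n m : ℕ) (s t r : ℝ) :
    expProfile n s r * expProfile m t r = expProfile (n + m) (s + t) r := by
  rcases le_or_gt r 0 with hr | hr
  · simp [expProfile_of_nonpos _ _ hr]
  · rw [expProfile_of_pos _ _ hr, expProfile_of_pos _ _ hr, expProfile_of_pos _ _ hr, add_mul,
      Real.exp_add, pow_add, mul_inv]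
    ring

theorem mul_expProfile_succ (n : ℕ) (t r : ℝ) :
    r * expProfile (n + 1) t r = expProfile n t r := by
  rcases le_or_gt r 0 with hr | hr
  · simp [expProfile_of_nonpos _ _ hr]
  · rw [expProfile_of_pos _ _ hr, expProfile_of_pos _ _ hr, pow_succ]
    field_simp

theorem Real.abs_exp_sub_one_sub_id_le_sq_mul_exp_abs (x : ℝ) :
    |Real.exp x - 1 - x| ≤ x ^ 2 * Real.exp |x| := by
  have h1 := Real.add_one_le_exp x
  have h2 : Real.exp x - 1 ≤ x * Real.exp x := by
    have h := Real.add_one_le_exp (-x)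
    have := mul_le_mul_of_nonneg_right h (Real.exp_pos x).le
    rw [← Real.exp_add, neg_add_cancel, Real.exp_zero] at this
    linarith
  rw [abs_of_nonneg (by linarith)]
  rcases le_total 0 x with hx | hx
  · rw [abs_of_nonneg hx]
    nlinarith [Real.exp_pos x]
  · have h3 : 1 ≤ Real.exp |x| := Real.one_le_exp (abs_nonneg x)
    nlinarith [sq_nonneg x]

theorem abs_expProfile_sub_sub_le (n : ℕ) {t h r : ℝ} (hh : |h| ≤ t / 2) (hr1 : r ≤ 1) :
    |expProfile n (t + h) r - expProfile n t r
      - h * (expProfile n t r - expProfile (n + 1) t r)| ≤ h ^ 2 * expProfile (n + 2) (t / 2) r := by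
  rcases le_or_gt r 0 with hr | hr
  · simp [expProfile_of_nonpos _ _ hr]
  simp only [expProfile_of_pos _ _ hr]
  set a := r⁻¹ - 1 with ha
  have hr' : 1 ≤ r⁻¹ := (one_le_inv₀ hr).2 hr1
  have ha0 : 0 ≤ a := by linarith
  have e1 : 1 - r⁻¹ = -a := by ring
  have e2 : (r ^ (n + 1))⁻¹ = (r ^ n)⁻¹ * (a + 1) := by rw [pow_succ, mul_inv]; simp [ha]
  have e3 : (r ^ (n + 2))⁻¹ = (r ^ n)⁻¹ * (a + 1) ^ 2 := by rw [pow_add, mul_inv]; simp [ha]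
  rw [e1, e2, e3]
  have key := Real.abs_exp_sub_one_sub_id_le_sq_mul_exp_abs (h * -a)
  have e4 : (r ^ n)⁻¹ * Real.exp ((t + h) * -a) - (r ^ n)⁻¹ * Real.exp (t * -a) -
      h * ((r ^ n)⁻¹ * Real.exp (t * -a) - (r ^ n)⁻¹ * (a + 1) * Real.exp (t * -a)) =
      (r ^ n)⁻¹ * Real.exp (t * -a) * (Real.exp (h * -a) - 1 - h * -a) := by
    rw [add_mul, Real.exp_add]; ring
  have hp : 0 < (r ^ n)⁻¹ := inv_pos.2 (pow_pos hr n)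
  rw [e4, abs_mul, abs_of_pos (mul_pos hp (Real.exp_pos _))]
  have e5 : Real.exp (t * -a) * Real.exp |h * -a| ≤ Real.exp (t / 2 * -a) := by
    rw [← Real.exp_add, abs_mul, abs_neg, abs_of_nonneg ha0]
    apply Real.exp_le_exp.2
    nlinarith
  calc (r ^ n)⁻¹ * Real.exp (t * -a) * |Real.exp (h * -a) - 1 - h * -a|
      ≤ (r ^ n)⁻¹ * Real.exp (t * -a) * ((h * -a) ^ 2 * Real.exp |h * -a|) := by gcongr
    _ = (r ^ n)⁻¹ * (h ^ 2 * a ^ 2) * (Real.exp (t * -a) * Real.exp |h * -a|) := by ring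
    _ ≤ (r ^ n)⁻¹ * (h ^ 2 * (a + 1) ^ 2) * Real.exp (t / 2 * -a) := by gcongr; linarith
    _ = _ := by ring

/-- The elementary estimate `(1 + a)² exp (-t a) ≤ 2 + 4 t⁻²` for `a ≥ 0`, the source of the
small-time singularity of the heat kernel. -/
theorem expProfile_two_le {t r : ℝ} (ht : 0 < t) (hr1 : r ≤ 1) :
    expProfile 2 t r ≤ 2 + 4 * t ^ (-2 : ℤ) := by
  rcases le_or_gt r 0 with hr | hr
  · rw [expProfile_of_nonpos _ _ hr]; positivity
  rw [expProfile_of_pos _ _ hr]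
  set a := r⁻¹ - 1 with ha
  have hr' : 1 ≤ r⁻¹ := (one_le_inv₀ hr).2 hr1
  have ha0 : 0 ≤ a := by linarith
  have e1 : 1 - r⁻¹ = -a := by ring
  have e2 : (r ^ 2)⁻¹ = (a + 1) ^ 2 := by simp [ha]
  rw [e1, e2]
  have h1 : Real.exp (t * -a) ≤ 1 := Real.exp_le_one_iff.2 (by nlinarith)
  have h2 : (t * a) ^ 2 * Real.exp (t * -a) ≤ 2 := by
    have h := Real.quadratic_le_exp_of_nonneg (mul_nonneg ht.le ha0)
    have h3 : Real.exp (t * -a) * Real.exp (t * a) = 1 := by rw [← Real.exp_add]; simp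
    have := Real.exp_pos (t * -a)
    have h4 : 0 ≤ t * a := mul_nonneg ht.le ha0
    nlinarith
  have h3 : t ^ (-2 : ℤ) = (t ^ 2)⁻¹ := by rw [zpow_neg]; norm_cast
  have h4 : a ^ 2 * Real.exp (t * -a) ≤ 2 * (t ^ 2)⁻¹ := by
    rw [← div_eq_mul_inv, le_div_iff₀ (by positivity)]
    linarith
  have h5 : (a + 1) ^ 2 ≤ 2 + 2 * a ^ 2 := by nlinarith [sq_nonneg (a - 1)]
  rw [h3]
  nlinarith [Real.exp_pos (t * -a)]

/-- Strong convergence of uniformly bounded operators may be checked on a dense set. -/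
theorem tendsto_apply_of_dense {H : Type*} [NormedAddCommGroup H] [InnerProductSpace ℂ H]
    {ι : Type*} {l : Filter ι} {Q : ι → H →L[ℂ] H} {S : H →L[ℂ] H}
    {C : ℝ} (hQ : ∀ᶠ i in l, ‖Q i‖ ≤ C) {A : Set H} (hA : Dense A)
    (h : ∀ a ∈ A, Tendsto (fun i => Q i a) l (𝓝 (S a))) (v : H) :
    Tendsto (fun i => Q i v) l (𝓝 (S v)) := by
  rw [Metric.tendsto_nhds]
  intro ε hε
  set M := max C 0 + ‖S‖ + 1 with hM
  have hC0 : 0 ≤ max C 0 := le_max_right _ _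
  have hM0 : 0 < M := by positivity
  obtain ⟨a, haA, ha⟩ := hA.exists_dist_lt v (show 0 < ε / (2 * M) by positivity)
  filter_upwards [hQ, Metric.tendsto_nhds.1 (h a haA) (ε / 2) (half_pos hε)] with i hi hi2
  rw [dist_eq_norm] at *
  have e : Q i v - S v = Q i (v - a) + (Q i a - S a) - S (v - a) := by
    rw [map_sub, map_sub]; abel
  rw [e]
  have h1 : ‖Q i (v - a)‖ ≤ max C 0 * ‖v - a‖ :=
    (Q i).le_of_opNorm_le (hi.trans (le_max_left _ _)) _
  have h2 := S.le_opNorm (v - a)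
  have h3 : M * ‖v - a‖ < ε / 2 := by
    have := mul_lt_mul_of_pos_left ha hM0
    have e2 : M * (ε / (2 * M)) = ε / 2 := by field_simp
    linarith
  calc _ ≤ ‖Q i (v - a)‖ + ‖Q i a - S a‖ + ‖S (v - a)‖ :=
        (norm_sub_le _ _).trans (by gcongr; exact norm_add_le _ _)
    _ < ε := by nlinarith [norm_nonneg (v - a)]

section HeatPower

variable {H : Type*} [NormedAddCommGroup H] [InnerProductSpace ℂ H] [CompleteSpace H]

/-- `heatPower R n t` is the operator `(1 - Δ)ⁿ exp (t Δ)`, where `R = (1 - Δ)⁻¹`. -/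
noncomputable def heatPower (R : H →L[ℂ] H) (n : ℕ) (t : ℝ) : H →L[ℂ] H := cfc (expProfile n t) R

variable {R : H →L[ℂ] H}

theorem isSelfAdjoint_heatPower (n : ℕ) (t : ℝ) : IsSelfAdjoint (heatPower R n t) :=
  cfc_predicate _ _

theorem heatPower_mul (n m : ℕ) {s t : ℝ} (hs : 0 < s) (ht : 0 < t) :
    heatPower R n s * heatPower R m t = heatPower R (n + m) (s + t) := by
  rw [heatPower, heatPower, heatPower, ← cfc_mul _ _ R (continuous_expProfile n hs).continuousOn
    (continuous_expProfile m ht).continuousOn]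
  simp only [expProfile_mul]

theorem mul_heatPower_succ (hR : IsSelfAdjoint R) (n : ℕ) {t : ℝ} (ht : 0 < t) :
    R * heatPower R (n + 1) t = heatPower R n t := by
  have h := cfc_mul (fun r : ℝ => r) _ R continuousOn_id
    (continuous_expProfile (n + 1) ht).continuousOn
  rw [cfc_id' ℝ R hR] at h
  rw [heatPower, heatPower, ← h]
  simp only [mul_expProfile_succ]

theorem heatPower_succ_mul (hR : IsSelfAdjoint R) (n : ℕ) {t : ℝ} (ht : 0 < t) :
    heatPower R (n + 1) t * R = heatPower R n t := by
  have h := congrArg star (mul_heatPower_succ hR n ht)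
  rwa [star_mul, hR.star_eq, (isSelfAdjoint_heatPower (n + 1) t).star_eq,
    (isSelfAdjoint_heatPower n t).star_eq] at h

theorem spectrum_subset_Icc (hR : R.IsPositive) (h1 : ‖R‖ ≤ 1) : spectrum ℝ R ⊆ Icc 0 1 := by
  intro r hr
  refine ⟨?_, ?_⟩
  · exact spectrum_nonneg_of_nonneg ((ContinuousLinearMap.nonneg_iff_isPositive R).2 hR) hr
  · rcases subsingleton_or_nontrivial H with _ | _
    · simp [spectrum.of_subsingleton] at hr
    exact (le_abs_self r).trans ((spectrum.norm_le_norm_of_mem hr).trans h1)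

theorem norm_heatPower_two_le (hR : R.IsPositive) (h1 : ‖R‖ ≤ 1) {t : ℝ} (ht : 0 < t) :
    ‖heatPower R 2 t‖ ≤ 2 + 4 * t ^ (-2 : ℤ) := by
  refine norm_cfc_le (by positivity) fun r hr => ?_
  have hr := spectrum_subset_Icc hR h1 hr
  rw [Real.norm_eq_abs, abs_of_nonneg]
  · exact expProfile_two_le ht hr.2
  · rcases hr.1.eq_or_lt with h | h
    · rw [expProfile_of_nonpos _ _ h.ge]
    · rw [expProfile_of_pos _ _ h]; positivity

theorem norm_heatPower_zero_le (hR : R.IsPositive) (h1 : ‖R‖ ≤ 1) {t : ℝ} (ht : 0 < t) :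
    ‖heatPower R 0 t‖ ≤ 1 := by
  refine norm_cfc_le zero_le_one fun r hr => ?_
  have hr := spectrum_subset_Icc hR h1 hr
  rcases le_or_gt r 0 with h | h
  · simp [expProfile_of_nonpos _ _ h]
  · rw [expProfile_of_pos _ _ h]
    have : t * (1 - r⁻¹) ≤ 0 :=
      mul_nonpos_of_nonneg_of_nonpos ht.le (by linarith [(one_le_inv₀ h).2 hr.2])
    simpa using Real.exp_le_one_iff.2 this

/-- In operator norm, `d/dt (1 - Δ)ⁿ exp (t Δ) = (1 - (1 - Δ)) (1 - Δ)ⁿ exp (t Δ)`. -/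
theorem hasDerivAt_heatPower (hR : R.IsPositive) (h1 : ‖R‖ ≤ 1) (n : ℕ) {t : ℝ} (ht : 0 < t) :
    HasDerivAt (heatPower R n) (heatPower R n t - heatPower R (n + 1) t) t := by
  have hc := fun m {s : ℝ} (hs : 0 < s) =>
    (continuous_expProfile m hs).continuousOn (s := spectrum ℝ R)
  rw [hasDerivAt_iff_isLittleO_nhds_zero]
  refine Asymptotics.IsBigO.trans_isLittleO (g := fun h : ℝ => h ^ 2) ?_
    (Asymptotics.isLittleO_pow_id one_lt_two)
  obtain ⟨K, hK⟩ := isCompact_Icc.exists_bound_of_continuousOn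
    (continuous_expProfile (n + 2) (half_pos ht)).continuousOn (s := Icc (0 : ℝ) 1)
  refine Asymptotics.IsBigO.of_bound K ?_
  have hev : ∀ᶠ h : ℝ in 𝓝 0, |h| < t / 2 := by
    filter_upwards [Metric.ball_mem_nhds (0 : ℝ) (half_pos ht)] with h hh
    simpa using hh
  filter_upwards [hev] with h hh
  have hth : 0 < t + h := by linarith [neg_abs_le h]
  have e : heatPower R n (t + h) - heatPower R n t
      - h • (heatPower R n t - heatPower R (n + 1) t) =
      cfc (fun r => expProfile n (t + h) r - expProfile n t r
        - h * (expProfile n t r - expProfile (n + 1) t r)) R := by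
    rw [cfc_sub (fun r => expProfile n (t + h) r - expProfile n t r)
        (fun r => h * (expProfile n t r - expProfile (n + 1) t r)) R
        ((hc n hth).sub (hc n ht)) (((hc n ht).sub (hc (n + 1) ht)).const_mul h),
      cfc_sub _ _ R (hc n hth) (hc n ht),
      cfc_const_mul _ (fun r => expProfile n t r - expProfile (n + 1) t r) R
        ((hc n ht).sub (hc (n + 1) ht)),
      cfc_sub _ _ R (hc n ht) (hc (n + 1) ht)]
    rfl
  rw [e]
  have hK0 : 0 ≤ K := (norm_nonneg _).trans (hK 0 ⟨le_rfl, zero_le_one⟩)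
  refine norm_cfc_le (by positivity) fun r hr => ?_
  have hr := spectrum_subset_Icc hR h1 hr
  refine (abs_expProfile_sub_sub_le n hh.le hr.2).trans ?_
  rw [Real.norm_eq_abs, abs_of_nonneg (sq_nonneg h), mul_comm]
  exact mul_le_mul_of_nonneg_right ((le_abs_self _).trans (hK r hr)) (sq_nonneg h)

/-- The semigroup `exp (t Δ)`, `t ≥ 0`, where `R = (1 - Δ)⁻¹`. -/
noncomputable def heatSemigroup (R : H →L[ℂ] H) (t : ℝ) : H →L[ℂ] H :=
  if 0 < t then heatPower R 0 t else 1

theorem heatSemigroup_of_pos {t : ℝ} (ht : 0 < t) : heatSemigroup R t = heatPower R 0 t :=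
  if_pos ht

theorem heatSemigroup_zero : heatSemigroup R 0 = 1 := if_neg (lt_irrefl 0)

theorem heatSemigroup_add {s t : ℝ} (hs : 0 ≤ s) (ht : 0 ≤ t) :
    heatSemigroup R (s + t) = heatSemigroup R s * heatSemigroup R t := by
  rcases hs.eq_or_lt with rfl | hs
  · rw [zero_add, heatSemigroup_zero, one_mul]
  rcases ht.eq_or_lt with rfl | ht
  · rw [add_zero, heatSemigroup_zero, mul_one]
  rw [heatSemigroup_of_pos hs, heatSemigroup_of_pos ht, heatSemigroup_of_pos (add_pos hs ht),
    heatPower_mul 0 0 hs ht]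

theorem norm_heatSemigroup_le (hR : R.IsPositive) (h1 : ‖R‖ ≤ 1) (t : ℝ) :
    ‖heatSemigroup R t‖ ≤ 1 := by
  rw [heatSemigroup]
  split_ifs with ht
  · exact norm_heatPower_zero_le hR h1 ht
  · exact ContinuousLinearMap.norm_id_le

theorem dense_range_of_injective_of_isSelfAdjoint (hR : IsSelfAdjoint R)
    (hinj : ∀ v, R v = 0 → v = 0) : Dense (range R) := by
  have h : (LinearMap.range (R : H →ₗ[ℂ] H))ᗮ = ⊥ := by
    rw [Submodule.eq_bot_iff]
    intro v hv
    refine hinj v (ext_inner_left ℂ fun w => ?_)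
    rw [inner_zero_right, ← ContinuousLinearMap.adjoint_inner_left,
      ContinuousLinearMap.isSelfAdjoint_iff'.1 hR]
    exact (Submodule.mem_orthogonal _ v).1 hv _ ⟨w, rfl⟩
  have := (Submodule.dense_iff_topologicalClosure_eq_top).2
    ((Submodule.topologicalClosure_eq_top_iff).2 h)
  exact this

theorem norm_heatPower_zero_mul_sub_le (hR : R.IsPositive) (h1 : ‖R‖ ≤ 1) {t : ℝ} (ht : 0 < t) :
    ‖heatPower R 0 t * R - R‖ ≤ t := by
  have hc := (continuous_expProfile 0 ht).continuousOn (s := spectrum ℝ R)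
  have hsa := hR.isSelfAdjoint
  have e : heatPower R 0 t * R - R = cfc (fun r => expProfile 0 t r * r - r) R := by
    rw [cfc_sub (fun r => expProfile 0 t r * r) (fun r => r) R (hc.mul continuousOn_id)
      continuousOn_id, cfc_mul _ (fun r => r) R hc continuousOn_id, cfc_id' ℝ R hsa]
    rfl
  rw [e]
  refine norm_cfc_le ht.le fun r hr => ?_
  have hr := spectrum_subset_Icc hR h1 hr
  rcases hr.1.eq_or_lt with rfl | h
  · simpa using ht.le
  rw [expProfile_of_pos _ _ h]
  have ha := Real.add_one_le_exp (t * (1 - r⁻¹))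
  have hb : Real.exp (t * (1 - r⁻¹)) ≤ 1 := Real.exp_le_one_iff.2
    (mul_nonpos_of_nonneg_of_nonpos ht.le (by linarith [(one_le_inv₀ h).2 hr.2]))
  have hc : t * (1 - r⁻¹) * r = t * (r - 1) := by field_simp
  rw [Real.norm_eq_abs, abs_le]
  simp only [pow_zero, inv_one, one_mul]
  constructor <;> nlinarith [hr.2]

/-- On the range of `R`, the difference quotients of the semigroup converge to the generator at a
rate that is linear in `t`. -/
theorem norm_slope_heatPower_zero_mul_le (hR : R.IsPositive) (h1 : ‖R‖ ≤ 1) {t : ℝ}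
    (ht : 0 < t) :
    ‖(t⁻¹ • (heatPower R 0 t * R - R) - (R - 1)) * R‖ ≤ t := by
  have hc := (continuous_expProfile 0 ht).continuousOn (s := spectrum ℝ R)
  have hsa := hR.isSelfAdjoint
  have e : (t⁻¹ • (heatPower R 0 t * R - R) - (R - 1)) * R =
      cfc (fun r => (t⁻¹ * (expProfile 0 t r * r - r) - (r - 1)) * r) R := by
    have hc1 : ContinuousOn (fun r => expProfile 0 t r * r - r) (spectrum ℝ R) :=
      (hc.mul continuousOn_id).sub continuousOn_id
    rw [cfc_mul (fun r => t⁻¹ * (expProfile 0 t r * r - r) - (r - 1)) (fun r => r) R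
        ((hc1.const_mul _).sub (continuousOn_id.sub continuousOn_const)) continuousOn_id,
      cfc_sub (fun r => t⁻¹ * (expProfile 0 t r * r - r)) (fun r => r - 1) R
        (hc1.const_mul _) (continuousOn_id.sub continuousOn_const),
      cfc_const_mul _ _ R hc1, cfc_sub (fun r => expProfile 0 t r * r) (fun r => r) R
        (hc.mul continuousOn_id) continuousOn_id, cfc_mul _ (fun r => r) R hc continuousOn_id,
      cfc_sub (fun r => r) (fun _ => 1) R continuousOn_id continuousOn_const,
      cfc_id' ℝ R hsa, cfc_const_one ℝ R hsa]
    rfl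
  rw [e]
  refine norm_cfc_le ht.le fun r hr => ?_
  have hr := spectrum_subset_Icc hR h1 hr
  rcases hr.1.eq_or_lt with rfl | h
  · simpa using ht.le
  rw [expProfile_of_pos _ _ h, pow_zero, inv_one, one_mul]
  set a := r⁻¹ - 1 with ha
  have ha0 : 0 ≤ a := by linarith [(one_le_inv₀ h).2 hr.2]
  have e1 : 1 - r⁻¹ = -a := by ring
  have e2 : r - 1 = -(a * r) := by rw [ha]; field_simp; ring
  rw [e1]
  have k1 := Real.add_one_le_exp (t * -a)
  have k2 : Real.exp (t * -a) - 1 - t * -a ≤ (t * a) ^ 2 := by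
    have k3 := Real.add_one_le_exp (t * a)
    have k4 : Real.exp (t * -a) * Real.exp (t * a) = 1 := by rw [← Real.exp_add]; simp
    have k5 := Real.exp_pos (t * -a)
    have k6 : 0 ≤ t * a := mul_nonneg ht.le ha0
    nlinarith
  have e3 : (t⁻¹ * (Real.exp (t * -a) * r - r) - (r - 1)) * r =
      t⁻¹ * r ^ 2 * (Real.exp (t * -a) - 1 - t * -a) := by
    rw [e2]; field_simp
  rw [e3, Real.norm_eq_abs, abs_of_nonneg (mul_nonneg (by positivity) (by linarith))]
  calc _ ≤ t⁻¹ * r ^ 2 * (t * a) ^ 2 := by gcongr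
    _ = t * (a * r) ^ 2 := by field_simp
    _ ≤ t * 1 := by
      gcongr
      have : a * r = 1 - r := by linarith
      rw [this]
      nlinarith [hr.2]
    _ = t := mul_one t

theorem continuousOn_heatSemigroup (hR : R.IsPositive) (h1 : ‖R‖ ≤ 1)
    (hinj : ∀ v, R v = 0 → v = 0) (u : H) :
    ContinuousOn (fun t => heatSemigroup R t u) (Ici 0) := by
  intro t ht
  rcases (show 0 ≤ t from ht).eq_or_lt with rfl | ht
  · have key : Tendsto (fun t => heatSemigroup R t u) (𝓝[>] 0) (𝓝 ((1 : H →L[ℂ] H) u)) := by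
      refine tendsto_apply_of_dense (C := 1)
        (Eventually.of_forall fun t => norm_heatSemigroup_le hR h1 t)
        (dense_range_of_injective_of_isSelfAdjoint hR.isSelfAdjoint hinj) ?_ u
      rintro _ ⟨v, rfl⟩
      rw [tendsto_iff_norm_sub_tendsto_zero]
      have : Tendsto (fun t : ℝ => t * ‖v‖) (𝓝[>] 0) (𝓝 0) := by
        have : Tendsto (fun t : ℝ => t * ‖v‖) (𝓝 0) (𝓝 (0 * ‖v‖)) :=
          (continuous_id.mul continuous_const).tendsto 0
        rw [zero_mul] at this
        exact this.mono_left nhdsWithin_le_nhds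
      refine squeeze_zero' (Eventually.of_forall fun _ => norm_nonneg _) ?_ this
      filter_upwards [self_mem_nhdsWithin] with t ht
      rw [heatSemigroup_of_pos ht]
      exact (heatPower R 0 t * R - R).le_of_opNorm_le (norm_heatPower_zero_mul_sub_le hR h1 ht) v
    rw [ContinuousWithinAt, heatSemigroup_zero, ← Ioi_insert, nhdsWithin_insert]
    refine Tendsto.sup ?_ key
    simpa [heatSemigroup_zero] using tendsto_pure_nhds (fun t => heatSemigroup R t u) 0
  · have hd := (hasDerivAt_heatPower hR h1 0 ht).continuousAt
    have h2 : ContinuousAt (fun t => heatPower R 0 t u) t := hd.clm_apply continuousAt_const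
    refine (h2.congr ?_).continuousWithinAt
    filter_upwards [Ioi_mem_nhds ht] with s hs
    rw [heatSemigroup_of_pos hs]

/-- The generator of the semigroup is `1 - R⁻¹`. -/
theorem tendsto_slope_heatSemigroup_iff (hR : R.IsPositive) (h1 : ‖R‖ ≤ 1)
    (hinj : ∀ v, R v = 0 → v = 0) (u w : H) :
    Tendsto (fun t : ℝ => t⁻¹ • (heatSemigroup R t u - u)) (𝓝[>] 0) (𝓝 w) ↔ R (u - w) = u := by
  have hsa := hR.isSelfAdjoint
  -- strong convergence on the range of `R`, by density and the uniform bound `1`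
  have key : ∀ v, Tendsto (fun t : ℝ => (t⁻¹ • (heatPower R 0 t * R - R)) v) (𝓝[>] 0)
      (𝓝 ((R - 1) v)) := by
    refine fun v => tendsto_apply_of_dense (C := 1) ?_
      (dense_range_of_injective_of_isSelfAdjoint hsa hinj) ?_ v
    · filter_upwards [self_mem_nhdsWithin] with t ht
      have ht : 0 < t := ht
      rw [norm_smul, norm_inv, Real.norm_eq_abs, abs_of_pos ht, inv_mul_le_iff₀ ht, mul_one]
      exact norm_heatPower_zero_mul_sub_le hR h1 ht
    · rintro _ ⟨v, rfl⟩
      rw [tendsto_iff_norm_sub_tendsto_zero]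
      have : Tendsto (fun t : ℝ => t * ‖v‖) (𝓝[>] 0) (𝓝 0) := by
        have : Tendsto (fun t : ℝ => t * ‖v‖) (𝓝 0) (𝓝 (0 * ‖v‖)) :=
          (continuous_id.mul continuous_const).tendsto 0
        rw [zero_mul] at this
        exact this.mono_left nhdsWithin_le_nhds
      refine squeeze_zero' (Eventually.of_forall fun _ => norm_nonneg _) ?_ this
      filter_upwards [self_mem_nhdsWithin] with t ht
      exact ((t⁻¹ • (heatPower R 0 t * R - R) - (R - 1)) * R).le_of_opNorm_le
        (norm_slope_heatPower_zero_mul_le hR h1 ht) v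
  have key' : ∀ v, Tendsto (fun t : ℝ => t⁻¹ • (heatSemigroup R t (R v) - R v)) (𝓝[>] 0)
      (𝓝 (R v - v)) := by
    intro v
    refine (key v).congr' ?_
    filter_upwards [self_mem_nhdsWithin] with t ht
    rw [heatSemigroup_of_pos ht]
    rfl
  constructor
  -- apply `R`, which commutes with the semigroup, and compare the two limits of the quotients
  · intro h
    have h2 : Tendsto (fun t : ℝ => t⁻¹ • (heatSemigroup R t (R u) - R u)) (𝓝[>] 0)
        (𝓝 (R w)) := by
      refine ((R.continuous.tendsto w).comp h).congr' ?_
      filter_upwards [self_mem_nhdsWithin] with t ht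
      have ht : 0 < t := ht
      have hcomm : R * heatPower R 0 t = heatPower R 0 t * R := by
        rw [← heatPower_succ_mul hsa 0 ht, ← mul_assoc, mul_heatPower_succ hsa 0 ht,
          heatPower_succ_mul hsa 0 ht]
      rw [Function.comp, heatSemigroup_of_pos ht, ContinuousLinearMap.map_smul_of_tower, map_sub]
      congr 2
      exact congrArg (fun S : H →L[ℂ] H => S u) hcomm
    have h3 := tendsto_nhds_unique h2 (key' u)
    rw [map_sub, h3, sub_sub_cancel]
  · intro h
    have := key' (u - w)
    rwa [h, sub_sub_cancel] at this

end HeatPower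

/-! ### Uniqueness of the semigroup with a dissipative generator -/

section

variable {H : Type*} [NormedAddCommGroup H] [InnerProductSpace ℂ H]

/-- Orbits starting in the domain of the generator stay there and are differentiable from the
right. Here `A u w` says that `u` is in the domain of the generator, which maps it to `w`. -/
theorem hasDerivWithinAt_semigroup {A : H → H → Prop} {S : ℝ → H →L[ℂ] H}
    (hadd : ∀ s t, 0 ≤ s → 0 ≤ t → S (s + t) = S s ∘L S t)
    (hgen : ∀ u w, A u w ↔ Tendsto (fun t : ℝ => t⁻¹ • (S t u - u)) (𝓝[>] 0) (𝓝 w))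
    {u w : H} (h : A u w) {t : ℝ} (ht : 0 ≤ t) :
    A (S t u) (S t w) ∧ HasDerivWithinAt (fun s => S s u) (S t w) (Ici t) t := by
  have h1 : Tendsto (fun s : ℝ => s⁻¹ • (S t (S s u) - S t u)) (𝓝[>] 0) (𝓝 (S t w)) := by
    refine (((S t).continuous.tendsto w).comp ((hgen u w).1 h)).congr fun s => ?_
    simp [ContinuousLinearMap.map_smul_of_tower]
  refine ⟨(hgen _ _).2 (h1.congr' ?_), ?_⟩
  · filter_upwards [self_mem_nhdsWithin] with s hs
    have hs : 0 ≤ s := le_of_lt hs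
    have e : S t (S s u) = S s (S t u) := by
      rw [← ContinuousLinearMap.comp_apply, ← hadd t s ht hs, add_comm, hadd s t hs ht]; rfl
    rw [e]
  · rw [← hasDerivWithinAt_Ioi_iff_Ici, hasDerivWithinAt_iff_tendsto_slope' (by simp)]
    have h2 : Tendsto (fun s : ℝ => s - t) (𝓝[>] t) (𝓝[>] 0) := by
      refine tendsto_nhdsWithin_iff.2 ⟨?_, ?_⟩
      · have : Tendsto (fun s : ℝ => s - t) (𝓝 t) (𝓝 (t - t)) :=
          (continuous_id.sub continuous_const).tendsto t
        rw [sub_self] at this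
        exact this.mono_left nhdsWithin_le_nhds
      · filter_upwards [self_mem_nhdsWithin] with s hs
        exact sub_pos.2 (mem_Ioi.1 hs)
    refine (h1.comp h2).congr' ?_
    filter_upwards [self_mem_nhdsWithin] with s hs
    have hs : 0 ≤ s - t := sub_nonneg.2 (le_of_lt hs)
    rw [Function.comp, slope_def_module, ← ContinuousLinearMap.comp_apply, ← hadd t _ ht hs,
      add_sub_cancel]

/-- Two semigroups with the same densely defined dissipative generator agree, since the squared
distance of two orbits with the same initial value is nonincreasing. -/
theorem semigroup_eq_of_generator_eq {A : H → H → Prop} {S S' : ℝ → H →L[ℂ] H}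
    (hdiss : ∀ u u' w w', A u w → A u' w' → (⟪u - u', w - w'⟫_ℂ).re ≤ 0)
    (hdense : Dense {u | ∃ w, A u w})
    (hz : S 0 = 1) (hadd : ∀ s t, 0 ≤ s → 0 ≤ t → S (s + t) = S s ∘L S t)
    (hc : ∀ u, ContinuousOn (fun t => S t u) (Ici 0))
    (hgen : ∀ u w, A u w ↔ Tendsto (fun t : ℝ => t⁻¹ • (S t u - u)) (𝓝[>] 0) (𝓝 w))
    (hz' : S' 0 = 1) (hadd' : ∀ s t, 0 ≤ s → 0 ≤ t → S' (s + t) = S' s ∘L S' t)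
    (hc' : ∀ u, ContinuousOn (fun t => S' t u) (Ici 0))
    (hgen' : ∀ u w, A u w ↔ Tendsto (fun t : ℝ => t⁻¹ • (S' t u - u)) (𝓝[>] 0) (𝓝 w))
    {t : ℝ} (ht : 0 ≤ t) : S t = S' t := by
  refine ContinuousLinearMap.coeFn_injective
    ((S t).continuous.ext_on hdense (S' t).continuous ?_)
  rintro u ⟨w, huw⟩
  let : InnerProductSpace ℝ H := InnerProductSpace.rclikeToReal ℂ H
  have hsub : Icc 0 t ⊆ Ici 0 := fun s hs => hs.1
  have hcont : ContinuousOn (fun s => ‖S s u - S' s u‖ ^ 2) (Icc 0 t) :=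
    ((((hc u).mono hsub).sub ((hc' u).mono hsub)).norm).pow 2
  have hle := image_le_of_deriv_right_le_deriv_boundary
    (f' := fun s => 2 * inner ℝ (S s u - S' s u) (S s w - S' s w)) hcont
    (fun s hs => ?_) (B := fun _ => 0) (B' := fun _ => 0) ?_ continuousOn_const
    (fun s _ => hasDerivWithinAt_const _ _ _) (fun s hs => ?_) ⟨ht, le_rfl⟩
  · have := pow_eq_zero_iff (two_ne_zero) |>.1 (le_antisymm hle (sq_nonneg _))
    exact sub_eq_zero.1 (norm_eq_zero.1 this)
  · exact ((hasDerivWithinAt_semigroup hadd hgen huw hs.1).2.sub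
      (hasDerivWithinAt_semigroup hadd' hgen' huw hs.1).2).norm_sq
  · simp [hz, hz']
  · have := hdiss _ _ _ _ (hasDerivWithinAt_semigroup hadd hgen huw hs.1).1
      (hasDerivWithinAt_semigroup hadd' hgen' huw hs.1).1
    have e : inner ℝ (S s u - S' s u) (S s w - S' s w) =
      (⟪S s u - S' s u, S s w - S' s w⟫_ℂ).re := rfl
    simp only [e]
    linarith

end

namespace MetricGraph

variable {V E : Type*} {G : MetricGraph V E}

/-! ### Metric and topology of a metric graph -/

theorem pt_of_mem_Ioo {e : E} {s : ℝ} (hs : s ∈ Ioo 0 (G.len e)) :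
    G.pt e s = Point.inner e s hs.1 hs.2 := by simp [pt, hs.1, hs.2]

theorem pt_of_nonpos (e : E) {s : ℝ} (hs : s ≤ 0) : G.pt e s = Point.vertex (G.src e) :=
  dif_neg hs.not_gt

theorem pt_of_len_le {e : E} {s : ℝ} (hs : G.len e ≤ s) : G.pt e s = Point.vertex (G.tgt e) := by
  rw [pt, dif_pos ((G.len_pos e).trans_le hs), dif_neg hs.not_gt]

/-- A function on the graph that is `K`-Lipschitz on every closed edge is `K`-Lipschitz. -/
theorem lipschitzWith_of_edges {X : Type*} [PseudoMetricSpace X] {K : ℝ≥0} (hK : K ≠ 0)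
    {f : G.Point → X} (h : ∀ e, LipschitzOnWith K (fun s => f (G.pt e s)) (Icc 0 (G.len e))) :
    LipschitzWith K f := by
  have key : ∀ x y L, G.PathLength x y L → edist (f x) (f y) ≤ K * (L : ℝ≥0∞) := by
    intro x y L hL
    induction hL with
    | nil x => simp
    | cons e s t hs ht y L _ ih =>
      refine (edist_triangle _ (f (G.pt e t)) _).trans ?_
      rw [ENNReal.coe_add, mul_add]
      refine add_le_add ?_ ih
      rw [← edist_nndist]
      exact h e hs ht
  intro x y
  change _ ≤ (K : ℝ≥0∞) * ⨅ (L : ℝ≥0) (_ : G.PathLength x y L), (L : ℝ≥0∞)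
  have hK' : (K : ℝ≥0∞) ≠ 0 := ENNReal.coe_ne_zero.2 hK
  simp only [ENNReal.mul_iInf_of_ne hK' ENNReal.coe_ne_top]
  exact le_iInf₂ fun L hL => key x y L hL

theorem exists_pathLength (hconn : G.IsConnected) (x y : G.Point) : ∃ L, G.PathLength x y L := by
  have hseg : ∀ e, ∀ s ∈ Icc 0 (G.len e), ∀ t ∈ Icc 0 (G.len e),
      ∃ L, G.PathLength (G.pt e s) (G.pt e t) L := fun e s hs t ht =>
    ⟨_, PathLength.cons e s t hs ht _ _ (PathLength.nil _)⟩
  have htrans : ∀ {x y z : G.Point}, (∃ L, G.PathLength x y L) → (∃ L, G.PathLength y z L) →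
      ∃ L, G.PathLength x z L := fun ⟨_, h⟩ ⟨_, h'⟩ => ⟨_, h.append h'⟩
  have hsymm : ∀ {x y : G.Point}, (∃ L, G.PathLength x y L) → ∃ L, G.PathLength y x L :=
    fun ⟨_, h⟩ => ⟨_, h.symm⟩
  have hedge : ∀ e, ∃ L, G.PathLength (Point.vertex (G.src e)) (Point.vertex (G.tgt e)) L := by
    intro e
    have := hseg e 0 ⟨le_rfl, (G.len_pos e).le⟩ _ ⟨(G.len_pos e).le, le_rfl⟩
    rwa [pt_of_nonpos e le_rfl, pt_of_len_le le_rfl] at this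
  have hvert : ∀ u v, ∃ L, G.PathLength (Point.vertex u) (Point.vertex v) L := by
    intro u v
    have h := (SimpleGraph.reachable_iff_reflTransGen u v).1 (hconn.preconnected u v)
    induction h with
    | refl => exact ⟨_, PathLength.nil _⟩
    | tail _ hadj ih =>
      refine htrans ih ?_
      obtain ⟨_, ⟨e, rfl, rfl⟩ | ⟨e, rfl, rfl⟩⟩ := (SimpleGraph.fromRel_adj _ _ _).1 hadj
      · exact hedge e
      · exact hsymm (hedge e)
  have hpt : ∀ x : G.Point, ∃ v L, G.PathLength x (Point.vertex v) L := by
    rintro (v | ⟨e, s, h₀, h₁⟩)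
    · exact ⟨v, hvert v v⟩
    · refine ⟨G.src e, ?_⟩
      have := hseg e s ⟨h₀.le, h₁.le⟩ 0 ⟨le_rfl, (G.len_pos e).le⟩
      rwa [pt_of_nonpos e le_rfl, pt_of_mem_Ioo ⟨h₀, h₁⟩] at this
  obtain ⟨u, hu⟩ := hpt x
  obtain ⟨v, hv⟩ := hpt y
  exact htrans (htrans hu (hvert u v)) (hsymm hv)

theorem edist_ne_top (hconn : G.IsConnected) (x y : G.Point) : edist x y ≠ ⊤ := by
  obtain ⟨L, hL⟩ := exists_pathLength hconn x y
  exact ne_top_of_le_ne_top (ENNReal.coe_ne_top (r := L)) (iInf₂_le L hL)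

theorem d_nonneg (x y : G.Point) : 0 ≤ G.d x y := ENNReal.toReal_nonneg

theorem dist_le_mul_d (hconn : G.IsConnected) {X : Type*} [PseudoMetricSpace X] {K : ℝ≥0}
    {f : G.Point → X} (hf : LipschitzWith K f) (x y : G.Point) :
    dist (f x) (f y) ≤ K * G.d x y := by
  have h := ENNReal.toReal_mono (ENNReal.mul_ne_top ENNReal.coe_ne_top (edist_ne_top hconn x y))
    (hf x y)
  rwa [ENNReal.toReal_mul, edist_dist, ENNReal.toReal_ofReal dist_nonneg] at h

theorem exists_pt_eq (hconn : G.IsConnected) [Nonempty E] (x : G.Point) :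
    ∃ e, ∃ s ∈ Icc 0 (G.len e), G.pt e s = x := by
  rcases x with v | ⟨e, s, h₀, h₁⟩
  · suffices ∃ e, G.src e = v ∨ G.tgt e = v by
      obtain ⟨e, rfl | rfl⟩ := this
      · exact ⟨e, 0, ⟨le_rfl, (G.len_pos e).le⟩, pt_of_nonpos e le_rfl⟩
      · exact ⟨e, _, ⟨(G.len_pos e).le, le_rfl⟩, pt_of_len_le le_rfl⟩
    obtain ⟨e₀⟩ := ‹Nonempty E›
    rcases eq_or_ne (G.src e₀) v with h | h
    · exact ⟨e₀, Or.inl h⟩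
    · have h := (SimpleGraph.reachable_iff_reflTransGen _ _).1 (hconn.preconnected (G.src e₀) v)
      rcases Relation.ReflTransGen.cases_tail h with h | ⟨w, -, hw⟩
      · exact ⟨e₀, Or.inl h.symm⟩
      · obtain ⟨_, ⟨e, _, h⟩ | ⟨e, h, _⟩⟩ := (SimpleGraph.fromRel_adj _ _ _).1 hw
        · exact ⟨e, Or.inr h⟩
        · exact ⟨e, Or.inl h⟩
  · exact ⟨e, s, ⟨h₀.le, h₁.le⟩, pt_of_mem_Ioo ⟨h₀, h₁⟩⟩

theorem countable_vertices (hconn : G.IsConnected) (hfin : G.LocallyFinite) : Countable V := by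
  obtain ⟨v₀⟩ := hconn.nonempty
  -- `N v` contains the neighbours of `v`, and `B n` the vertices reached from `v₀` in `n` steps
  let N : V → Set V := fun v =>
    G.src '' {e | G.src e = v ∨ G.tgt e = v} ∪ G.tgt '' {e | G.src e = v ∨ G.tgt e = v}
  let B : ℕ → Set V := fun n => Nat.rec {v₀} (fun _ S => ⋃ v ∈ S, N v) n
  have hB : ∀ n, (B n).Countable := by
    intro n
    induction n with
    | zero => exact countable_singleton v₀
    | succ n ih =>
      exact ih.biUnion fun v _ => ((hfin v).image _ |>.union ((hfin v).image _)).countable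
  have hU : ∀ v, v ∈ ⋃ n, B n := by
    intro v
    have h := (SimpleGraph.reachable_iff_reflTransGen v₀ v).1 (hconn.preconnected v₀ v)
    induction h with
    | refl => exact mem_iUnion.2 ⟨0, rfl⟩
    | @tail u w _ hadj ih =>
      obtain ⟨n, hn⟩ := mem_iUnion.1 ih
      refine mem_iUnion.2 ⟨n + 1, mem_iUnion₂.2 ⟨u, hn, ?_⟩⟩
      obtain ⟨_, ⟨e, h, h'⟩ | ⟨e, h, h'⟩⟩ := (SimpleGraph.fromRel_adj _ _ _).1 hadj
      · exact Or.inr ⟨e, Or.inl h, h'⟩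
      · exact Or.inl ⟨e, Or.inr h', h⟩
  exact countable_univ_iff.1 ((countable_iUnion hB).mono fun v _ => hU v)

theorem countable_edges (hconn : G.IsConnected) (hfin : G.LocallyFinite) : Countable E := by
  have := countable_vertices hconn hfin
  exact countable_univ_iff.1 ((countable_iUnion fun v => (hfin v).countable).mono
    fun e _ => mem_iUnion.2 ⟨G.src e, Or.inl rfl⟩)

theorem secondCountableTopology_point [Countable V] [Countable E] :
    SecondCountableTopology G.Point := by
  have h : TopologicalSpace.IsSeparable (univ : Set G.Point) := by
    have h1 : TopologicalSpace.IsSeparable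
        ((⋃ e, range (G.pt e)) ∪ range (Point.vertex : V → G.Point)) :=
      (TopologicalSpace.IsSeparable.iUnion fun e =>
        TopologicalSpace.isSeparable_range (G.lipschitzWith_pt e).continuous).union
        (countable_range _).isSeparable
    refine h1.mono ?_
    rintro (v | ⟨e, s, h₀, h₁⟩) -
    · exact Or.inr ⟨v, rfl⟩
    · exact Or.inl (mem_iUnion.2 ⟨e, s, pt_of_mem_Ioo ⟨h₀, h₁⟩⟩)
  have := TopologicalSpace.isSeparable_univ_iff.1 h
  exact UniformSpace.secondCountable_of_separable G.Point

/-! ### Functions supported on one edge -/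

open Classical in
/-- The function on the graph that is `φ` on the open edge `e` and `0` elsewhere. -/
noncomputable def edgeExtend (G : MetricGraph V E) (e : E) (φ : ℝ → ℂ) : G.Point → ℂ
  | .vertex _ => 0
  | .inner e' s _ _ => if e' = e then φ s else 0

theorem edgeExtend_pt_self {e : E} {φ : ℝ → ℂ} (hφ : Function.support φ ⊆ Ioo 0 (G.len e))
    (s : ℝ) : G.edgeExtend e φ (G.pt e s) = φ s := by
  by_cases hs : s ∈ Ioo 0 (G.len e)
  · rw [pt_of_mem_Ioo hs]; exact if_pos rfl
  · rw [Function.notMem_support.1 fun h => hs (hφ h)]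
    rw [mem_Ioo, not_and_or, not_lt, not_lt] at hs
    rcases hs with hs | hs
    · rw [pt_of_nonpos e hs]; rfl
    · rw [pt_of_len_le hs]; rfl

theorem edgeExtend_pt_of_ne {e e' : E} (he : e' ≠ e) (φ : ℝ → ℂ) (s : ℝ) :
    G.edgeExtend e φ (G.pt e' s) = 0 := by
  rw [pt]
  split_ifs
  · exact if_neg he
  · rfl
  · rfl

theorem continuous_edgeExtend {e : E} {φ : ℝ → ℂ} {K : ℝ≥0} (hφK : LipschitzWith K φ)
    (hφ : Function.support φ ⊆ Ioo 0 (G.len e)) : Continuous (G.edgeExtend e φ) := by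
  refine (lipschitzWith_of_edges (K := K + 1) (by positivity) fun e' =>
    LipschitzWith.lipschitzOnWith ?_).continuous
  by_cases he : e' = e
  · subst he
    simpa only [edgeExtend_pt_self hφ] using hφK.weaken (by simp)
  · simp only [edgeExtend_pt_of_ne he]
    exact LipschitzWith.const' 0

/-- The set of the interior points of an edge. -/
def openEdge (G : MetricGraph V E) (e : E) : Set G.Point := G.pt e '' Ioo 0 (G.len e)

theorem isOpen_openEdge (e : E) : IsOpen (G.openEdge e) := by
  -- the open edge is where the tent function of height `len e / 2` on this edge does not vanish
  let τ : ℝ → ℂ := fun s => ((max 0 (min s (G.len e - s)) : ℝ) : ℂ)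
  have hτ : LipschitzWith 1 τ := by
    have h1 : LipschitzWith 1 (fun s : ℝ => G.len e - s) :=
      LipschitzWith.of_dist_le_mul fun s t => by simp [dist_eq_norm, abs_sub_comm]
    have h2 := (LipschitzWith.id.min h1).const_max 0
    rw [max_self] at h2
    have h3 := Complex.isometry_ofReal.lipschitz.comp h2
    rw [mul_one] at h3
    exact h3
  have hpos : ∀ s, τ s ≠ 0 ↔ s ∈ Ioo 0 (G.len e) := by
    intro s
    simp only [τ, Complex.ofReal_ne_zero, ne_eq, max_eq_left_iff, not_le, lt_min_iff, mem_Ioo,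
      sub_pos]
  have hsupp : Function.support τ ⊆ Ioo 0 (G.len e) := fun s hs => (hpos s).1 hs
  have : G.openEdge e = (G.edgeExtend e τ) ⁻¹' {0}ᶜ := by
    ext x
    constructor
    · rintro ⟨s, hs, rfl⟩
      rw [mem_preimage, edgeExtend_pt_self hsupp]
      exact (hpos s).2 hs
    · intro hx
      rcases x with v | ⟨e', s, h₀, h₁⟩
      · exact (hx rfl).elim
      · by_cases he : e' = e
        · subst he
          exact ⟨s, ⟨h₀, h₁⟩, pt_of_mem_Ioo ⟨h₀, h₁⟩⟩
        · exact (hx (if_neg he)).elim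
  rw [this]
  exact isOpen_compl_singleton.preimage (continuous_edgeExtend hτ hsupp)

theorem pt_mem_openEdge_iff {e e' : E} {s : ℝ} (hs : s ∈ Ioo 0 (G.len e')) :
    G.pt e' s ∈ G.openEdge e ↔ e' = e := by
  constructor
  · rintro ⟨t, ht, h⟩
    rw [pt_of_mem_Ioo hs, pt_of_mem_Ioo ht] at h
    exact (Point.inner.inj h).1.symm
  · rintro rfl
    exact ⟨s, hs, rfl⟩

/-! ### Integration on a metric graph -/

theorem map_pt_le_vol (e : E) : (volume.restrict (Ioo 0 (G.len e))).map (G.pt e) ≤ G.vol :=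
  Measure.le_sum _ e

theorem ae_pt_of_ae {P : G.Point → Prop} (h : ∀ᵐ x ∂G.vol, P x) (e : E) :
    ∀ᵐ s ∂volume.restrict (Ioo 0 (G.len e)), P (G.pt e s) :=
  ae_of_ae_map (G.measurable_pt e).aemeasurable (ae_mono (map_pt_le_vol e) h)

theorem ae_of_ae_pt {P : G.Point → Prop} (hP : MeasurableSet {x | P x})
    (h : ∀ e, ∀ᵐ s ∂volume.restrict (Ioo 0 (G.len e)), P (G.pt e s)) :
    ∀ᵐ x ∂G.vol, P x := by
  rw [vol, Measure.ae_sum_iff' hP]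
  exact fun e => (ae_map_iff (G.measurable_pt e).aemeasurable hP).2 (h e)

theorem aestronglyMeasurable_comp_pt {f : G.Point → ℂ} (hf : AEStronglyMeasurable f G.vol)
    (e : E) : AEStronglyMeasurable (fun s => f (G.pt e s)) (volume.restrict (Ioo 0 (G.len e))) :=
  (hf.mono_measure (map_pt_le_vol e)).comp_measurable (G.measurable_pt e)

theorem eLpNorm_comp_pt_le {f : G.Point → ℂ} (hf : AEStronglyMeasurable f G.vol) (p : ℝ≥0∞)
    (e : E) : eLpNorm (fun s => f (G.pt e s)) p (volume.restrict (Ioo 0 (G.len e))) ≤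
      eLpNorm f p G.vol := by
  rw [← Function.comp_def, ← eLpNorm_map_measure (hf.mono_measure (map_pt_le_vol e))
    (G.measurable_pt e).aemeasurable]
  exact eLpNorm_mono_measure _ (map_pt_le_vol e)

theorem _root_.MeasureTheory.MemLp.comp_pt {f : G.Point → ℂ} {p : ℝ≥0∞} (hf : MemLp f p G.vol)
    (e : E) : MemLp (fun s => f (G.pt e s)) p (volume.restrict (Ioo 0 (G.len e))) :=
  ⟨aestronglyMeasurable_comp_pt hf.1 e, (eLpNorm_comp_pt_le hf.1 p e).trans_lt hf.2⟩

theorem integrable_comp_pt {f : G.Point → ℂ} (hf : MemLp f 2 G.vol) (e : E) :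
    Integrable (fun s => f (G.pt e s)) (volume.restrict (Ioo 0 (G.len e))) :=
  (hf.comp_pt e).integrable one_le_two

theorem integral_vol_eq_of_edge {F : G.Point → ℂ} (hF : Integrable F G.vol) {e : E}
    (h : ∀ e' ≠ e, ∀ s, F (G.pt e' s) = 0) :
    ∫ x, F x ∂G.vol = ∫ s in Ioo 0 (G.len e), F (G.pt e s) := by
  have hmap : ∀ e', ∫ x, F x ∂((volume.restrict (Ioo 0 (G.len e'))).map (G.pt e')) =
      ∫ s in Ioo 0 (G.len e'), F (G.pt e' s) := fun e' =>
    integral_map (G.measurable_pt e').aemeasurable (hF.1.mono_measure (map_pt_le_vol e'))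
  have h1 := hasSum_integral_measure hF
  have h2 : HasSum (fun e' => ∫ x, F x ∂((volume.restrict (Ioo 0 (G.len e'))).map (G.pt e')))
      (∫ s in Ioo 0 (G.len e), F (G.pt e s)) := by
    rw [← hmap]
    refine hasSum_single e fun e' he' => ?_
    rw [hmap]
    simp [h e' he']
  exact h1.unique h2

theorem vol_openEdge (e : E) : G.vol (G.openEdge e) < ⊤ := by
  have hm := (isOpen_openEdge (G := G) e).measurableSet
  rw [vol, Measure.sum_apply _ hm, tsum_eq_single e]
  · rw [Measure.map_apply (G.measurable_pt e) hm]
    exact (measure_mono (subset_univ _)).trans_lt (measure_lt_top _ _)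
  · intro e' he'
    rw [Measure.map_apply (G.measurable_pt e') hm,
      Measure.restrict_apply (G.measurable_pt e' hm)]
    convert! measure_empty (μ := (volume : Measure ℝ))
    ext s
    simp only [mem_inter_iff, mem_preimage, mem_empty_iff_false, iff_false, not_and]
    exact fun h hs => he' ((pt_mem_openEdge_iff hs).1 h)

theorem sigmaFinite_vol [Countable E] : SigmaFinite G.vol := by
  have hm : MeasurableSet (⋃ e, G.openEdge e)ᶜ :=
    (MeasurableSet.iUnion fun e => (isOpen_openEdge (G := G) e).measurableSet).compl
  refine Measure.sigmaFinite_of_countable (S := insert (⋃ e, G.openEdge e)ᶜ (range G.openEdge))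
    ((countable_range _).insert _) ?_ ?_
  · rintro _ (rfl | ⟨e, rfl⟩)
    · have : ∀ᵐ x ∂G.vol, x ∈ ⋃ e, G.openEdge e := by
        refine ae_of_ae_pt (MeasurableSet.iUnion fun e =>
          (isOpen_openEdge (G := G) e).measurableSet) fun e => ?_
        filter_upwards [ae_restrict_mem measurableSet_Ioo] with s hs
        exact mem_iUnion.2 ⟨e, s, hs, rfl⟩
      rw [show G.vol (⋃ e, G.openEdge e)ᶜ = 0 from this]
      exact ENNReal.zero_lt_top
    · exact vol_openEdge e
  · rw [sUnion_insert, sUnion_range, compl_union_self]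

theorem memLp_edgeExtend {e : E} {φ : ℝ → ℂ} {K : ℝ≥0} (hφK : LipschitzWith K φ)
    (hφ : Function.support φ ⊆ Ioo 0 (G.len e)) (p : ℝ≥0∞) : MemLp (G.edgeExtend e φ) p G.vol := by
  have hm := (isOpen_openEdge (G := G) e).measurableSet
  have hind : (G.openEdge e).indicator (G.edgeExtend e φ) = G.edgeExtend e φ := by
    refine indicator_eq_self.2 fun x hx => ?_
    rcases x with v | ⟨e', s, h₀, h₁⟩
    · exact (hx rfl).elim
    · by_cases he : e' = e
      · subst he
        exact ⟨s, ⟨h₀, h₁⟩, pt_of_mem_Ioo ⟨h₀, h₁⟩⟩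
      · exact (hx (if_neg he)).elim
  obtain ⟨C, hC⟩ := isCompact_Icc.exists_bound_of_continuousOn
    hφK.continuous.continuousOn (s := Icc 0 (G.len e))
  rw [← hind, memLp_indicator_iff_restrict hm]
  have : IsFiniteMeasure (G.vol.restrict (G.openEdge e)) :=
    ⟨by rw [Measure.restrict_apply_univ]; exact vol_openEdge e⟩
  refine MemLp.of_bound (continuous_edgeExtend hφK hφ).aestronglyMeasurable C ?_
  filter_upwards [ae_restrict_mem hm]
  rintro _ ⟨s, hs, rfl⟩
  rw [edgeExtend_pt_self hφ]
  exact hC s (Ioo_subset_Icc_self hs)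

end MetricGraph

/-! ### Weak derivatives on an interval -/

section Interval

theorem IsCompact.exists_subset_Icc_of_subset_Ioo {K : Set ℝ} (hK : IsCompact K) {a b : ℝ}
    (hab : a < b) (h : K ⊆ Ioo a b) : ∃ c d, a < c ∧ d < b ∧ K ⊆ Icc c d := by
  rcases K.eq_empty_or_nonempty with rfl | hne
  · exact ⟨b, a, hab, hab, empty_subset _⟩
  · obtain ⟨c, hc⟩ := hK.exists_isLeast hne
    obtain ⟨d, hd⟩ := hK.exists_isGreatest hne
    exact ⟨c, d, (h hc.1).1, (h hd.1).2, fun x hx => ⟨hc.2 hx, hd.2 hx⟩⟩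

/-- A test function with mean zero is the derivative of a test function. -/
theorem exists_contDiff_deriv_eq {χ : ℝ → ℝ} {L : ℝ} (hL : 0 < L) (hχ : ContDiff ℝ ∞ χ)
    (hc : HasCompactSupport χ) (hs : tsupport χ ⊆ Ioo 0 L) (h0 : ∫ s in Ioo 0 L, χ s = 0) :
    ContDiff ℝ ∞ (fun t => ∫ s in (0 : ℝ)..t, χ s) ∧
      HasCompactSupport (fun t => ∫ s in (0 : ℝ)..t, χ s) ∧
      tsupport (fun t => ∫ s in (0 : ℝ)..t, χ s) ⊆ Ioo 0 L ∧
      deriv (fun t => ∫ s in (0 : ℝ)..t, χ s) = χ := by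
  set Φ : ℝ → ℝ := fun t => ∫ s in (0 : ℝ)..t, χ s with hΦ
  have hder : ∀ t, HasDerivAt Φ (χ t) t := fun t =>
    intervalIntegral.integral_hasDerivAt_right (hχ.continuous.intervalIntegrable _ _)
      (hχ.continuous.stronglyMeasurableAtFilter _ _) hχ.continuous.continuousAt
  have hderiv : deriv Φ = χ := funext fun t => (hder t).deriv
  obtain ⟨a, b, ha, hb, hab⟩ := hc.exists_subset_Icc_of_subset_Ioo hL hs
  have hz : ∀ s, s ∉ Icc a b → χ s = 0 := fun s hs' =>
    image_eq_zero_of_notMem_tsupport fun h => hs' (hab h)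
  have hsupp : Function.support Φ ⊆ Icc a b := by
    intro t ht
    by_contra hcon
    refine ht ?_
    rw [mem_Icc, not_and_or, not_le, not_le] at hcon
    rcases hcon with h | h
    · refine intervalIntegral.integral_zero_ae (ae_of_all _ fun s hs' => hz s fun hs'' => ?_)
      rw [uIoc, mem_Ioc] at hs'
      have : s ≤ max 0 t := hs'.2
      have : max 0 t < a := max_lt ha h
      linarith [hs''.1]
    · have e1 : ∫ s in (0 : ℝ)..L, χ s = 0 := by
        rw [intervalIntegral.integral_of_le hL.le, integral_Ioc_eq_integral_Ioo, h0]
      have e2 : ∫ s in t..L, χ s = 0 := by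
        refine intervalIntegral.integral_zero_ae (ae_of_all _ fun s hs' => hz s fun hs'' => ?_)
        rw [uIoc, mem_Ioc] at hs'
        have : min t L < s := hs'.1
        have : b < min t L := lt_min h hb
        linarith [hs''.2]
      have e3 := intervalIntegral.integral_add_adjacent_intervals
        (hχ.continuous.intervalIntegrable (μ := volume) 0 t)
        (hχ.continuous.intervalIntegrable t L)
      rw [e1, e2, add_zero] at e3
      exact e3
  have hts : tsupport Φ ⊆ Icc a b := closure_minimal hsupp isClosed_Icc
  refine ⟨contDiff_infty_iff_deriv.2 ⟨fun t => (hder t).differentiableAt, hderiv ▸ hχ⟩,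
    HasCompactSupport.of_support_subset_isCompact isCompact_Icc hsupp,
    hts.trans fun x hx => ⟨ha.trans_le hx.1, hx.2.trans_lt hb⟩, hderiv⟩

/-- Integration by parts for the primitive of an integrable function, by Fubini's theorem. -/
theorem integral_primitive_mul_eq {L : ℝ} {g : ℝ → ℂ} (hg : IntegrableOn g (Ioo 0 L))
    {χ : ℝ → ℝ} (hχ : Continuous χ) (h0 : ∫ s in Ioo 0 L, χ s = 0) :
    ∫ s in Ioo 0 L, (∫ τ in (0 : ℝ)..s, g τ) * (χ s : ℂ) =
      -∫ τ in Ioo 0 L, g τ * ((∫ s in (0 : ℝ)..τ, χ s : ℝ) : ℂ) := by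
  have hχi : IntegrableOn (fun s => (χ s : ℂ)) (Ioo 0 L) :=
    ((Complex.continuous_ofReal.comp hχ).continuousOn.integrableOn_Icc (a := 0) (b := L)).mono_set
      Ioo_subset_Icc_self
  have hint : Integrable (Function.uncurry fun s τ : ℝ =>
      {p : ℝ × ℝ | p.2 < p.1}.indicator (fun p => (χ p.1 : ℂ) * g p.2) (s, τ))
      ((volume.restrict (Ioo 0 L)).prod (volume.restrict (Ioo 0 L))) :=
    (hχi.mul_prod hg).indicator (measurableSet_lt measurable_snd measurable_fst)
  have hswap := integral_integral_swap hint
  have e1 : ∀ s ∈ Ioo 0 L, ∫ τ in Ioo 0 L,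
      {p : ℝ × ℝ | p.2 < p.1}.indicator (fun p => (χ p.1 : ℂ) * g p.2) (s, τ) =
      (∫ τ in (0 : ℝ)..s, g τ) * (χ s : ℂ) := by
    intro s hs
    have : ∀ τ, {p : ℝ × ℝ | p.2 < p.1}.indicator (fun p => (χ p.1 : ℂ) * g p.2) (s, τ) =
        (Iio s).indicator (fun τ => (χ s : ℂ) * g τ) τ := fun τ => rfl
    simp only [this]
    rw [setIntegral_indicator measurableSet_Iio, Ioo_inter_Iio, min_eq_right hs.2.le,
      integral_const_mul, intervalIntegral.integral_of_le hs.1.le, integral_Ioc_eq_integral_Ioo,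
      mul_comm]
  have e2 : ∀ τ ∈ Ioo 0 L, ∫ s in Ioo 0 L,
      {p : ℝ × ℝ | p.2 < p.1}.indicator (fun p => (χ p.1 : ℂ) * g p.2) (s, τ) =
      -(g τ * ((∫ s in (0 : ℝ)..τ, χ s : ℝ) : ℂ)) := by
    intro τ hτ
    have : ∀ s, {p : ℝ × ℝ | p.2 < p.1}.indicator (fun p => (χ p.1 : ℂ) * g p.2) (s, τ) =
        (Ioi τ).indicator (fun s => (χ s : ℂ) * g τ) s := fun τ => rfl
    simp only [this]
    rw [setIntegral_indicator measurableSet_Ioi, Ioo_inter_Ioi, max_eq_right hτ.1.le,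
      integral_mul_const, integral_complex_ofReal, mul_comm, ← mul_neg]
    congr 1
    rw [← Complex.ofReal_neg]
    congr 1
    have e3 := intervalIntegral.integral_add_adjacent_intervals
        (hχ.intervalIntegrable (μ := volume) 0 τ) (hχ.intervalIntegrable τ L)
    rw [intervalIntegral.integral_of_le (hτ.1.trans hτ.2).le,
      intervalIntegral.integral_of_le hτ.2.le, integral_Ioc_eq_integral_Ioo,
      integral_Ioc_eq_integral_Ioo, h0] at e3
    linarith
  rw [setIntegral_congr_fun measurableSet_Ioo e1, setIntegral_congr_fun measurableSet_Ioo e2,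
    integral_neg] at hswap
  exact hswap

/-- The du Bois-Reymond lemma: a function with an integrable weak derivative is a.e. equal to a
primitive of it. -/
theorem exists_ae_eq_const_add_primitive {L : ℝ} (hL : 0 < L) {f g : ℝ → ℂ}
    (hf : IntegrableOn f (Ioo 0 L)) (hg : IntegrableOn g (Ioo 0 L))
    (h : ∀ φ : ℝ → ℂ, ContDiff ℝ ∞ φ → HasCompactSupport φ → tsupport φ ⊆ Ioo 0 L →
      ∫ s in Ioo 0 L, f s * deriv φ s = -∫ s in Ioo 0 L, g s * φ s) :
    ∃ c : ℂ, ∀ᵐ s ∂volume.restrict (Ioo 0 L), f s = c + ∫ τ in (0 : ℝ)..s, g τ := by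
  -- a bump function with integral `1`, to be subtracted from test functions so as to make their
  -- mean vanish
  let ρ₀ : ContDiffBump (L / 2) := ⟨L / 8, L / 4, by positivity, by linarith⟩
  set ρ : ℝ → ℝ := ρ₀.normed volume with hρ
  have hρs : tsupport ρ ⊆ Ioo 0 L := by
    rw [hρ, ρ₀.tsupport_normed_eq, Real.closedBall_eq_Icc]
    intro s hs
    have : ρ₀.rOut = L / 4 := rfl
    rw [this] at hs
    exact ⟨by linarith [hs.1], by linarith [hs.2]⟩
  have hρc : HasCompactSupport ρ := ρ₀.hasCompactSupport_normed
  have hρd : ContDiff ℝ ∞ ρ := ρ₀.contDiff_normed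
  have hset : ∀ {F : Type} [NormedAddCommGroup F] [NormedSpace ℝ F] {u : ℝ → F},
      Function.support u ⊆ Ioo 0 L → ∫ s in Ioo 0 L, u s = ∫ s, u s := fun hu =>
    setIntegral_eq_integral_of_forall_compl_eq_zero fun s hs =>
      Function.notMem_support.1 fun h => hs (hu h)
  have hρ1 : ∫ s in Ioo 0 L, ρ s = 1 := by
    rw [hset ((subset_tsupport ρ).trans hρs)]
    exact ρ₀.integral_normed
  have hgi : IntervalIntegrable g volume 0 L :=
    (intervalIntegrable_iff_integrableOn_Ioo_of_le hL.le).2 hg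
  have hGc : ContinuousOn (fun s => ∫ τ in (0 : ℝ)..s, g τ) (Icc 0 L) := by
    have := intervalIntegral.continuousOn_primitive_interval'
      (by exact hgi) (left_mem_uIcc)
    rwa [uIcc_of_le hL.le] at this
  have hGi : IntegrableOn (fun s => ∫ τ in (0 : ℝ)..s, g τ) (Ioo 0 L) :=
    hGc.integrableOn_Icc.mono_set Ioo_subset_Icc_self
  set u : ℝ → ℂ := fun s => f s - ∫ τ in (0 : ℝ)..s, g τ with hu
  have hui : IntegrableOn u (Ioo 0 L) := hf.sub hGi
  have hmul : ∀ {v : ℝ → ℂ} {ψ : ℝ → ℝ}, IntegrableOn v (Ioo 0 L) → Continuous ψ →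
      HasCompactSupport ψ → IntegrableOn (fun s => v s * (ψ s : ℂ)) (Ioo 0 L) := by
    intro v ψ hv hψ hψc
    obtain ⟨C, hC⟩ := hψ.bounded_above_of_compact_support hψc
    refine Integrable.mul_bdd (c := C) hv
      (Complex.continuous_ofReal.comp hψ).aestronglyMeasurable (ae_of_all _ fun s => ?_)
    simpa using hC s
  -- `u` is orthogonal to all test functions with mean zero
  have horth : ∀ χ : ℝ → ℝ, ContDiff ℝ ∞ χ → HasCompactSupport χ → tsupport χ ⊆ Ioo 0 L →
      ∫ s in Ioo 0 L, χ s = 0 → ∫ s in Ioo 0 L, u s * (χ s : ℂ) = 0 := by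
    intro χ hχ hχc hχs hχ0
    obtain ⟨h1, h2, h3, h4⟩ := exists_contDiff_deriv_eq hL hχ hχc hχs hχ0
    set Φ : ℝ → ℝ := fun t => ∫ s in (0 : ℝ)..t, χ s with hΦ
    have hd : deriv (fun t => (Φ t : ℂ)) = fun t => (χ t : ℂ) := by
      funext t
      have h5 : HasDerivAt Φ (χ t) t := by
        rw [← h4]
        exact ((contDiff_infty_iff_deriv.1 h1).1 t).hasDerivAt
      exact h5.ofReal_comp.deriv
    have h6 := h (fun t => (Φ t : ℂ)) (Complex.ofRealCLM.contDiff.comp h1)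
      (h2.comp_left (g := fun r : ℝ => (r : ℂ)) Complex.ofReal_zero)
      ((tsupport_comp_subset (g := fun r : ℝ => (r : ℂ)) Complex.ofReal_zero Φ).trans h3)
    rw [hd] at h6
    have h7 := integral_primitive_mul_eq hg hχ.continuous hχ0
    simp only [hu, sub_mul]
    rw [integral_sub (hmul hf hχ.continuous hχc) (hmul hGi hχ.continuous hχc), h6, h7, sub_self]
  set c := ∫ s in Ioo 0 L, u s * (ρ s : ℂ) with hc
  refine ⟨c, ?_⟩
  have hae := isOpen_Ioo.ae_eq_zero_of_integral_contDiff_smul_eq_zero (μ := volume)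
    (f := fun s => u s - c) (U := Ioo 0 L)
    ((hui.sub (integrableOn_const (by simp))).locallyIntegrableOn) ?_
  · rw [ae_restrict_iff' measurableSet_Ioo]
    filter_upwards [hae] with s hs hs'
    have := hs hs'
    rw [sub_eq_zero] at this
    rw [← this, hu, sub_add_cancel]
  · intro ψ hψ hψc hψs
    set m := ∫ s in Ioo 0 L, ψ s with hm
    have hψi : IntegrableOn ψ (Ioo 0 L) := (hψ.continuous.integrable_of_hasCompactSupport hψc).integrableOn
    have hρi : IntegrableOn ρ (Ioo 0 L) := (hρd.continuous.integrable_of_hasCompactSupport hρc).integrableOn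
    -- the constant `c` is the mean of `u` with respect to `ρ`
    have h1 := horth (fun s => ψ s - m * ρ s) (hψ.sub (contDiff_const.mul hρd))
      (hψc.sub hρc.mul_left) ?_ ?_
    · have e : ∀ s, u s * ((ψ s - m * ρ s : ℝ) : ℂ) =
          u s * (ψ s : ℂ) - (m : ℂ) * (u s * (ρ s : ℂ)) := fun s => by push_cast; ring
      simp only [e] at h1
      rw [integral_sub (hmul hui hψ.continuous hψc)
        ((hmul hui hρd.continuous hρc).const_mul _), integral_const_mul, ← hc] at h1
      have hsupp : Function.support (fun s => ψ s • (u s - c)) ⊆ Ioo 0 L :=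
        (Function.support_smul_subset_left ψ _).trans ((subset_tsupport ψ).trans hψs)
      rw [← hset hsupp]
      have e2 : ∀ s, ψ s • (u s - c) = u s * (ψ s : ℂ) - (ψ s : ℂ) * c := fun s => by
        rw [Complex.real_smul]; ring
      simp only [e2]
      have hψi' : Integrable (fun s => (ψ s : ℂ) * c) (volume.restrict (Ioo 0 L)) :=
        (Integrable.ofReal (𝕜 := ℂ) hψi).mul_const c
      rw [integral_sub (hmul hui hψ.continuous hψc) hψi', integral_mul_const,
        integral_complex_ofReal, ← hm]
      exact h1
    · have hK : IsClosed (tsupport ψ ∪ tsupport ρ) :=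
        (isClosed_tsupport ψ).union (isClosed_tsupport ρ)
      refine (closure_minimal ?_ hK).trans (union_subset hψs hρs)
      intro s hs
      by_contra hcon
      rw [mem_union, not_or] at hcon
      refine hs ?_
      simp [image_eq_zero_of_notMem_tsupport hcon.1, image_eq_zero_of_notMem_tsupport hcon.2]
    · rw [integral_sub hψi (hρi.const_mul m), integral_const_mul, hρ1, mul_one, sub_self]

/-- The one-dimensional Sobolev inequality, with a constant that is uniform in the intervals of
length at least `c`. -/
theorem norm_le_of_forall_sub_eq_integral {c L : ℝ} (hc : 0 < c) (hcL : c ≤ L) {F g : ℝ → ℂ}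
    (hF2 : MemLp F 2 (volume.restrict (Ioo 0 L)))
    (hg2 : MemLp g 2 (volume.restrict (Ioo 0 L)))
    (h : ∀ s ∈ Icc 0 L, ∀ t ∈ Icc 0 L, F t - F s = ∫ τ in s..t, g τ) {s : ℝ}
    (hs : s ∈ Icc 0 L) :
    ‖F s‖ ≤ (c⁻¹ + 1) * √c * ((eLpNorm F 2 (volume.restrict (Ioo 0 L))).toReal +
      (eLpNorm g 2 (volume.restrict (Ioo 0 L))).toReal) := by
  -- `s` lies in the interval `[p, p + c]`, over which the values of `F` are averaged
  set p := min s (L - c) with hp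
  have hp0 : 0 ≤ p := le_min hs.1 (by linarith)
  have hpL : p + c ≤ L := by linarith [min_le_right s (L - c)]
  have hps : p ≤ s := min_le_left _ _
  have hsp : s ≤ p + c := by
    rcases le_total s (L - c) with h | h
    · rw [hp, min_eq_left h]; linarith
    · rw [hp, min_eq_right h]; linarith [hs.2]
  have hsub : Ioo p (p + c) ⊆ Ioo 0 L := Ioo_subset_Ioo hp0 hpL
  have hmeas : volume.restrict (Ioo p (p + c)) ≤ volume.restrict (Ioo 0 L) :=
    Measure.restrict_mono hsub le_rfl
  -- the Cauchy-Schwarz inequality on the interval `(p, p + c)`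
  have hCS : ∀ {u : ℝ → ℂ}, MemLp u 2 (volume.restrict (Ioo 0 L)) →
      ∫ τ in Ioo p (p + c), ‖u τ‖ ≤ √c * (eLpNorm u 2 (volume.restrict (Ioo 0 L))).toReal := by
    intro u hu
    have hu' := hu.mono_measure hmeas
    have h1 : ∫ τ in Ioo p (p + c), ‖u τ‖ =
        (eLpNorm u 1 (volume.restrict (Ioo p (p + c)))).toReal := by
      rw [eLpNorm_one_eq_lintegral_enorm, integral_norm_eq_lintegral_enorm hu'.1]
    have h2 := eLpNorm_le_eLpNorm_mul_rpow_measure_univ (one_le_two (α := ℝ≥0∞)) hu'.1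
    rw [Measure.restrict_apply_univ, Real.volume_Ioo, add_sub_cancel_left] at h2
    have h3 : eLpNorm u 1 (volume.restrict (Ioo p (p + c))) ≤
        eLpNorm u 2 (volume.restrict (Ioo 0 L)) * ENNReal.ofReal √c := by
      refine h2.trans (mul_le_mul' (eLpNorm_mono_measure _ hmeas) (le_of_eq ?_))
      rw [Real.sqrt_eq_rpow, ← ENNReal.ofReal_rpow_of_pos hc]
      norm_num
    rw [h1, mul_comm]
    refine (ENNReal.toReal_mono (ENNReal.mul_ne_top hu.2.ne ENNReal.ofReal_ne_top) h3).trans ?_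
    rw [ENNReal.toReal_mul, ENNReal.toReal_ofReal (Real.sqrt_nonneg _)]
  have hFi : IntegrableOn F (Ioo p (p + c)) :=
    (hF2.integrable one_le_two).mono_measure hmeas
  have hgi : IntegrableOn g (Ioo p (p + c)) :=
    (hg2.integrable one_le_two).mono_measure hmeas
  set Ig := ∫ τ in Ioo p (p + c), ‖g τ‖ with hIg
  have hpt : ∀ τ ∈ Ioo p (p + c), ‖F s‖ ≤ ‖F τ‖ + Ig := by
    intro τ hτ
    have h1 := h τ (Ioo_subset_Icc_self (hsub hτ)) s hs
    have h2 : ‖∫ x in τ..s, g x‖ ≤ Ig := by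
      refine intervalIntegral.norm_integral_le_integral_norm_uIoc.trans ?_
      rw [hIg, ← integral_Icc_eq_integral_Ioo]
      refine setIntegral_mono_set ?_ (ae_of_all _ fun _ => norm_nonneg _) ?_
      · rw [integrableOn_Icc_iff_integrableOn_Ioo]
        exact hgi.norm
      · refine LE.le.eventuallyLE (uIoc_subset_uIcc.trans ?_)
        exact uIcc_subset_Icc (Ioo_subset_Icc_self hτ) ⟨hps, hsp⟩
    rw [← h1] at h2
    have := norm_add_le (F τ) (F s - F τ)
    rw [add_sub_cancel] at this
    linarith
  have hint : c * ‖F s‖ ≤ (∫ τ in Ioo p (p + c), ‖F τ‖) + c * Ig := by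
    have hconst : ∀ r : ℝ, ∫ _ in Ioo p (p + c), r = c * r := fun r => by
      rw [setIntegral_const, Measure.real, Real.volume_Ioo, add_sub_cancel_left,
        ENNReal.toReal_ofReal hc.le, smul_eq_mul]
    rw [← hconst, ← hconst Ig, ← integral_add hFi.norm (integrableOn_const (by simp))]
    exact setIntegral_mono_on (integrableOn_const (by simp))
      (hFi.norm.add (integrableOn_const (by simp))) measurableSet_Ioo hpt
  have h1 := hCS hF2
  have h2 := hCS hg2
  set A := (eLpNorm F 2 (volume.restrict (Ioo 0 L))).toReal
  set B := (eLpNorm g 2 (volume.restrict (Ioo 0 L))).toReal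
  have hA : 0 ≤ A := ENNReal.toReal_nonneg
  have hB : 0 ≤ B := ENNReal.toReal_nonneg
  have hsc := Real.sqrt_nonneg c
  have h3 : ‖F s‖ ≤ c⁻¹ * (√c * A) + √c * B := by
    have h4 : c * ‖F s‖ ≤ √c * A + c * (√c * B) := by
      have := mul_le_mul_of_nonneg_left h2 hc.le
      linarith
    have h5 := mul_le_mul_of_nonneg_left h4 (inv_pos.2 hc).le
    rw [inv_mul_cancel_left₀ hc.ne', mul_add, inv_mul_cancel_left₀ hc.ne'] at h5
    exact h5
  have h6 : 0 ≤ c⁻¹ * (√c * B) := by positivity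
  have h7 : 0 ≤ √c * A := by positivity
  linarith

end Interval

namespace MetricGraph

variable {V E : Type*} {G : MetricGraph V E} {D : Set V}

/-! ### Test functions and weak derivatives on a metric graph -/

/-- `φ` is a smooth function with compact support in the open interval `(0, L)`. -/
structure IsTestFunction (L : ℝ) (φ : ℝ → ℂ) : Prop where
  contDiff : ContDiff ℝ ∞ φ
  hasCompactSupport : HasCompactSupport φ
  tsupport_subset : tsupport φ ⊆ Ioo 0 L

namespace IsTestFunction

variable {L : ℝ} {φ : ℝ → ℂ}

theorem deriv (h : IsTestFunction L φ) : IsTestFunction L (deriv φ) :=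
  ⟨(contDiff_infty_iff_deriv.1 h.contDiff).2, h.hasCompactSupport.deriv,
    (closure_mono support_deriv_subset).trans
      ((closure_minimal le_rfl (isClosed_tsupport φ)).trans h.tsupport_subset)⟩

theorem star (h : IsTestFunction L φ) : IsTestFunction L (fun s => conj (φ s)) :=
  ⟨Complex.conjCLE.contDiff.comp h.contDiff,
    h.hasCompactSupport.comp_left (g := fun z => (starRingEnd ℂ) z) (map_zero _),
    (tsupport_comp_subset (g := fun z => (starRingEnd ℂ) z) (map_zero _) φ).trans
      h.tsupport_subset⟩

theorem support_subset (h : IsTestFunction L φ) : Function.support φ ⊆ Ioo 0 L :=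
  (subset_tsupport φ).trans h.tsupport_subset

theorem exists_lipschitzWith (h : IsTestFunction L φ) : ∃ K, LipschitzWith K φ :=
  h.contDiff.lipschitzWith_of_hasCompactSupport h.hasCompactSupport (by simp)

theorem deriv_star (h : IsTestFunction L φ) (s : ℝ) :
    _root_.deriv (fun s => (starRingEnd ℂ) (φ s)) s = (starRingEnd ℂ) (_root_.deriv φ s) :=
  ((contDiff_infty_iff_deriv.1 h.contDiff).1 s).hasDerivAt.star.deriv

theorem memLp_edgeExtend {e : E} (h : IsTestFunction (G.len e) φ) (p : ℝ≥0∞) :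
    MemLp (G.edgeExtend e φ) p G.vol :=
  MetricGraph.memLp_edgeExtend h.exists_lipschitzWith.choose_spec h.support_subset p

theorem continuous_edgeExtend {e : E} (h : IsTestFunction (G.len e) φ) :
    Continuous (G.edgeExtend e φ) :=
  MetricGraph.continuous_edgeExtend h.exists_lipschitzWith.choose_spec h.support_subset

end IsTestFunction

theorem inner_edgeExtend {e : E} {φ : ℝ → ℂ} (h : IsTestFunction (G.len e) φ) (u : G.L2) :
    ⟪(h.memLp_edgeExtend 2).toLp _, u⟫_ℂ =
      ∫ s in Ioo 0 (G.len e), u (G.pt e s) * conj (φ s) := by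
  have hae : ∀ᵐ x ∂G.vol, ⟪(h.memLp_edgeExtend 2).toLp _ x, u x⟫_ℂ =
      u x * conj (G.edgeExtend e φ x) := by
    filter_upwards [(h.memLp_edgeExtend 2).coeFn_toLp] with x hx
    rw [hx, RCLike.inner_apply]
  rw [L2.inner_def, integral_congr_ae hae, integral_vol_eq_of_edge (e := e)]
  · simp only [edgeExtend_pt_self h.support_subset]
  · exact (L2.integrable_inner ((h.memLp_edgeExtend 2).toLp _) u).congr hae
  · intro e' he' s
    rw [edgeExtend_pt_of_ne he', map_zero, mul_zero]

theorem locallyIntegrableOn_comp_pt {f : G.Point → ℂ} (hf : MemLp f 2 G.vol) (e : E) :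
    LocallyIntegrableOn (fun s => f (G.pt e s)) (Ioo 0 (G.len e)) :=
  IntegrableOn.locallyIntegrableOn (integrable_comp_pt hf e)

theorem IsWeakDeriv.congr_ae {f f' g g' : G.Point → ℂ} (h : G.IsWeakDeriv f f')
    (hf : f =ᵐ[G.vol] g) (hf' : f' =ᵐ[G.vol] g') (hg : MemLp g 2 G.vol)
    (hg' : MemLp g' 2 G.vol) : G.IsWeakDeriv g g' := by
  intro e
  have hfe : ∀ᵐ s ∂volume.restrict (Ioo 0 (G.len e)), f (G.pt e s) = g (G.pt e s) :=
    ae_pt_of_ae hf e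
  have hfe' : ∀ᵐ s ∂volume.restrict (Ioo 0 (G.len e)), f' (G.pt e s) = g' (G.pt e s) :=
    ae_pt_of_ae hf' e
  refine ⟨locallyIntegrableOn_comp_pt hg e, locallyIntegrableOn_comp_pt hg' e,
    fun φ a b c => ?_⟩
  have e1 : ∫ s in Ioo 0 (G.len e), f (G.pt e s) * deriv φ s =
      ∫ s in Ioo 0 (G.len e), g (G.pt e s) * deriv φ s :=
    integral_congr_ae (hfe.mono fun s hs => by simp only [hs])
  have e2 : ∫ s in Ioo 0 (G.len e), f' (G.pt e s) * φ s =
      ∫ s in Ioo 0 (G.len e), g' (G.pt e s) * φ s :=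
    integral_congr_ae (hfe'.mono fun s hs => by simp only [hs])
  rw [← e1, ← e2]
  exact (h e).2.2 φ a b c

theorem isWeakDeriv_iff_inner (u u' : G.L2) :
    G.IsWeakDeriv u u' ↔ ∀ e φ (h : IsTestFunction (G.len e) φ),
      ⟪(h.deriv.memLp_edgeExtend 2).toLp _, u⟫_ℂ = -⟪(h.memLp_edgeExtend 2).toLp _, u'⟫_ℂ := by
  constructor
  · intro hw e φ h
    have h1 := (hw e).2.2 _ h.star.contDiff h.star.hasCompactSupport h.star.tsupport_subset
    rw [inner_edgeExtend h, inner_edgeExtend h.deriv]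
    simpa only [h.deriv_star] using h1
  · intro hw e
    refine ⟨locallyIntegrableOn_comp_pt (Lp.memLp u) e,
      locallyIntegrableOn_comp_pt (Lp.memLp u') e, fun φ a b c => ?_⟩
    have h : IsTestFunction (G.len e) φ := ⟨a, b, c⟩
    have h1 := hw e _ h.star
    rw [inner_edgeExtend h.star, inner_edgeExtend h.star.deriv] at h1
    simpa only [h.deriv_star, Complex.conj_conj] using h1

theorem IsWeakDeriv.star {f f' : G.Point → ℂ} (h : G.IsWeakDeriv f f') :
    G.IsWeakDeriv (fun x => conj (f x)) (fun x => conj (f' x)) := by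
  intro e
  obtain ⟨h1, h2, h3⟩ := h e
  have hli : ∀ {u : ℝ → ℂ}, LocallyIntegrableOn u (Ioo 0 (G.len e)) →
      LocallyIntegrableOn (fun s => (starRingEnd ℂ) (u s)) (Ioo 0 (G.len e)) := by
    intro u hu s hs
    obtain ⟨t, ht, hi⟩ := hu s hs
    exact ⟨t, ht, Complex.conjCLE.toContinuousLinearMap.integrable_comp hi⟩
  refine ⟨hli h1, hli h2, fun φ a b c => ?_⟩
  have hφ : IsTestFunction (G.len e) φ := ⟨a, b, c⟩
  have h4 := congrArg (starRingEnd ℂ)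
    (h3 _ hφ.star.contDiff hφ.star.hasCompactSupport hφ.star.tsupport_subset)
  rw [map_neg, ← integral_conj, ← integral_conj] at h4
  simpa only [hφ.deriv_star, map_mul, Complex.conj_conj] using h4

theorem MemFormDomain.star {f f' : G.Point → ℂ} (h : G.MemFormDomain D f f') :
    G.MemFormDomain D (fun x => conj (f x)) (fun x => conj (f' x)) where
  continuous := Complex.continuous_conj.comp h.continuous
  memLp := h.memLp.star
  memLp_deriv := h.memLp_deriv.star
  isWeakDeriv := h.isWeakDeriv.star
  dirichlet v hv := by simp [h.dirichlet v hv]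

/-- The Laplacian commutes with complex conjugation. -/
theorem IsLaplacian.star {f g : G.Point → ℂ} (h : G.IsLaplacian D f g) :
    G.IsLaplacian D (fun x => conj (f x)) (fun x => conj (g x)) := by
  obtain ⟨hg, f₀, f', hf, hm, hw⟩ := h
  refine ⟨hg.star, fun x => (starRingEnd ℂ) (f₀ x), fun x => (starRingEnd ℂ) (f' x),
    hf.mono fun x hx => by simp only [hx], hm.star, fun h h' hh => ?_⟩
  have h1 := congrArg (starRingEnd ℂ) (hw _ _ hh.star)
  rw [map_neg, ← integral_conj, ← integral_conj] at h1
  simpa only [map_mul, Complex.conj_conj] using h1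

theorem IsTestFunction.memFormDomain {e : E} {φ : ℝ → ℂ} (h : IsTestFunction (G.len e) φ) :
    G.MemFormDomain D (G.edgeExtend e φ) (G.edgeExtend e (_root_.deriv φ)) where
  continuous := h.continuous_edgeExtend
  memLp := h.memLp_edgeExtend 2
  memLp_deriv := h.deriv.memLp_edgeExtend 2
  isWeakDeriv := by
    intro e'
    refine ⟨locallyIntegrableOn_comp_pt (h.memLp_edgeExtend 2) e',
      locallyIntegrableOn_comp_pt (h.deriv.memLp_edgeExtend 2) e', fun ψ a b c => ?_⟩
    by_cases he : e' = e
    · subst he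
      simp only [edgeExtend_pt_self h.support_subset, edgeExtend_pt_self h.deriv.support_subset]
      have hψ : IsTestFunction (G.len e') ψ := ⟨a, b, c⟩
      have hz : ∀ {a b : ℝ → ℂ}, Function.support a ⊆ Ioo 0 (G.len e') →
          ∫ s in Ioo 0 (G.len e'), a s * b s = ∫ s, a s * b s := by
        intro a b ha
        exact setIntegral_eq_integral_of_forall_compl_eq_zero fun s hs => by
          rw [Function.notMem_support.1 fun h => hs (ha h), zero_mul]
      rw [hz h.support_subset, hz h.deriv.support_subset]
      exact integral_mul_deriv_eq_deriv_mul_of_integrable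
        (fun s _ => ((contDiff_infty_iff_deriv.1 h.contDiff).1 s).hasDerivAt)
        (fun s _ => ((contDiff_infty_iff_deriv.1 a).1 s).hasDerivAt)
        ((h.contDiff.continuous.mul hψ.deriv.contDiff.continuous).integrable_of_hasCompactSupport
          h.hasCompactSupport.mul_right)
        ((h.deriv.contDiff.continuous.mul a.continuous).integrable_of_hasCompactSupport
          h.deriv.hasCompactSupport.mul_right)
        ((h.contDiff.continuous.mul a.continuous).integrable_of_hasCompactSupport
          h.hasCompactSupport.mul_right)
    · simp [edgeExtend_pt_of_ne he]
  dirichlet v _ := rfl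

/-! ### Sobolev functions on a metric graph -/

/-- Continuous functions that agree a.e. agree everywhere. -/
theorem eq_of_ae_eq (hconn : G.IsConnected) [Nonempty E] {f g : G.Point → ℂ} (hf : Continuous f)
    (hg : Continuous g) (h : f =ᵐ[G.vol] g) : f = g := by
  funext x
  obtain ⟨e, s, hs, rfl⟩ := exists_pt_eq hconn x
  have hc := (G.lipschitzWith_pt e).continuous
  have h1 : ∀ᵐ s ∂volume.restrict (Ioo 0 (G.len e)), f (G.pt e s) = g (G.pt e s) :=
    ae_pt_of_ae h e
  rw [Measure.restrict_congr_set Ioo_ae_eq_Icc] at h1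
  exact Measure.eqOn_Icc_of_ae_eq volume (G.len_pos e).ne h1 (hf.comp hc).continuousOn
    (hg.comp hc).continuousOn hs

theorem MemW12.sub_eq_integral {f f' : G.Point → ℂ} (h : G.MemW12 f f') (e : E) {s t : ℝ}
    (hs : s ∈ Icc 0 (G.len e)) (ht : t ∈ Icc 0 (G.len e)) :
    f (G.pt e t) - f (G.pt e s) = ∫ τ in s..t, f' (G.pt e τ) := by
  have hL := G.len_pos e
  have hi := integrable_comp_pt h.memLp_deriv e
  obtain ⟨c, hc⟩ := exists_ae_eq_const_add_primitive hL (integrable_comp_pt h.memLp e) hi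
    (h.isWeakDeriv e).2.2
  rw [Measure.restrict_congr_set Ioo_ae_eq_Icc] at hc
  have hii : IntervalIntegrable (fun τ => f' (G.pt e τ)) volume 0 (G.len e) :=
    (intervalIntegrable_iff_integrableOn_Ioo_of_le hL.le).2 hi
  have hprim := intervalIntegral.continuousOn_primitive_interval' hii left_mem_uIcc
  rw [uIcc_of_le hL.le] at hprim
  have heq := Measure.eqOn_Icc_of_ae_eq volume hL.ne hc
    (h.continuous.comp (G.lipschitzWith_pt e).continuous).continuousOn
    (continuousOn_const.add hprim)
  have hsub : ∀ {a}, a ∈ Icc 0 (G.len e) →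
      IntervalIntegrable (fun τ => f' (G.pt e τ)) volume 0 a := fun ha =>
    hii.mono_set (uIcc_subset_uIcc left_mem_uIcc (by rwa [uIcc_of_le hL.le]))
  have e1 := heq hs
  have e2 := heq ht
  simp only at e1 e2
  rw [e1, e2, ← intervalIntegral.integral_interval_sub_left (hsub ht) (hsub hs)]
  ring

theorem MemW12.norm_le (hconn : G.IsConnected) [Nonempty E] {c : ℝ} (hc : 0 < c)
    (hlen : ∀ e, c ≤ G.len e) {f f' : G.Point → ℂ} (h : G.MemW12 f f') (x : G.Point) :
    ‖f x‖ ≤ (c⁻¹ + 1) * √c * ((eLpNorm f 2 G.vol).toReal + (eLpNorm f' 2 G.vol).toReal) := by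
  obtain ⟨e, s, hs, rfl⟩ := exists_pt_eq hconn x
  refine (norm_le_of_forall_sub_eq_integral hc (hlen e) (h.memLp.comp_pt e)
    (h.memLp_deriv.comp_pt e) (fun s hs t ht => h.sub_eq_integral e hs ht) hs).trans ?_
  gcongr
  · exact h.memLp.2.ne
  · exact eLpNorm_comp_pt_le h.memLp.1 2 e
  · exact h.memLp_deriv.2.ne
  · exact eLpNorm_comp_pt_le h.memLp_deriv.1 2 e

/-- If the weak derivative has a weak derivative `w` on every edge, then it has a representative
`g` on every edge that is a primitive of `w` and is bounded uniformly in the edges; and `f` is a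
primitive of `g`. -/
theorem MemW12.exists_deriv_representative {c : ℝ} (hc : 0 < c)
    (hlen : ∀ e, c ≤ G.len e) {f f' w : G.Point → ℂ} (h : G.MemW12 f f')
    (hw : MemLp w 2 G.vol) (hf' : G.IsWeakDeriv f' w) (e : E) :
    ∃ g : ℝ → ℂ, ContinuousOn g (Icc 0 (G.len e)) ∧
      (∀ s ∈ Icc 0 (G.len e), ∀ t ∈ Icc 0 (G.len e),
        f (G.pt e t) - f (G.pt e s) = ∫ τ in s..t, g τ) ∧
      (∀ s ∈ Icc 0 (G.len e), ∀ t ∈ Icc 0 (G.len e), g t - g s = ∫ τ in s..t, w (G.pt e τ)) ∧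
      ∀ s ∈ Icc 0 (G.len e), ‖g s‖ ≤
        (c⁻¹ + 1) * √c * ((eLpNorm f' 2 G.vol).toReal + (eLpNorm w 2 G.vol).toReal) := by
  have hL := G.len_pos e
  have hi := integrable_comp_pt hw e
  obtain ⟨a, ha⟩ := exists_ae_eq_const_add_primitive hL (integrable_comp_pt h.memLp_deriv e) hi
    (hf' e).2.2
  have hii : IntervalIntegrable (fun τ => w (G.pt e τ)) volume 0 (G.len e) :=
    (intervalIntegrable_iff_integrableOn_Ioo_of_le hL.le).2 hi
  have hprim := intervalIntegral.continuousOn_primitive_interval' hii left_mem_uIcc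
  rw [uIcc_of_le hL.le] at hprim
  have hsub : ∀ {a}, a ∈ Icc 0 (G.len e) →
      IntervalIntegrable (fun τ => w (G.pt e τ)) volume 0 a := fun ha =>
    hii.mono_set (uIcc_subset_uIcc left_mem_uIcc (by rwa [uIcc_of_le hL.le]))
  set g : ℝ → ℂ := fun s => a + ∫ τ in (0 : ℝ)..s, w (G.pt e τ) with hg
  have hgw : ∀ s ∈ Icc 0 (G.len e), ∀ t ∈ Icc 0 (G.len e),
      g t - g s = ∫ τ in s..t, w (G.pt e τ) := by
    intro s hs t ht
    rw [← intervalIntegral.integral_interval_sub_left (hsub ht) (hsub hs), hg]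
    ring
  refine ⟨g, continuousOn_const.add hprim, ?_, hgw, ?_⟩
  · intro s hs t ht
    rw [h.sub_eq_integral e hs ht]
    refine intervalIntegral.integral_congr_ae ?_
    have ha' := ha
    rw [Measure.restrict_congr_set Ioo_ae_eq_Icc, ae_restrict_iff' measurableSet_Icc] at ha'
    filter_upwards [ha'] with τ hτ hτ'
    exact hτ (uIcc_subset_Icc hs ht (uIoc_subset_uIcc hτ'))
  · intro s hs
    have hm : MemLp g 2 (volume.restrict (Ioo 0 (G.len e))) :=
      (memLp_congr_ae ha).1 (h.memLp_deriv.comp_pt e)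
    refine (norm_le_of_forall_sub_eq_integral hc (hlen e) hm (hw.comp_pt e) hgw hs).trans ?_
    rw [← eLpNorm_congr_ae ha]
    gcongr
    · exact h.memLp_deriv.2.ne
    · exact eLpNorm_comp_pt_le h.memLp_deriv.1 2 e
    · exact hw.2.ne
    · exact eLpNorm_comp_pt_le hw.1 2 e

/-- The Sobolev inequality, applied to the first derivative, yields Lipschitz continuity. -/
theorem MemW12.norm_sub_le_mul_d (hconn : G.IsConnected) {c : ℝ} (hc : 0 < c)
    (hlen : ∀ e, c ≤ G.len e) {f f' w : G.Point → ℂ} (h : G.MemW12 f f')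
    (hw : MemLp w 2 G.vol) (hf' : G.IsWeakDeriv f' w) {M : ℝ}
    (hM : (eLpNorm f' 2 G.vol).toReal + (eLpNorm w 2 G.vol).toReal ≤ M) (x y : G.Point) :
    ‖f x - f y‖ ≤ (c⁻¹ + 1) * √c * M * G.d x y := by
  have key : ∀ ε : ℝ, 0 < ε → ‖f x - f y‖ ≤ ((c⁻¹ + 1) * √c * M + ε) * G.d x y := by
    -- `ε` makes the Lipschitz constant positive, as `lipschitzWith_of_edges` requires
    intro ε hε
    have hM0 : 0 ≤ M := (add_nonneg ENNReal.toReal_nonneg ENNReal.toReal_nonneg).trans hM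
    have hKpos : 0 < (c⁻¹ + 1) * √c * M + ε := by positivity
    set K : ℝ≥0 := ⟨(c⁻¹ + 1) * √c * M + ε, hKpos.le⟩ with hK
    have hlip : LipschitzWith K f := by
      refine lipschitzWith_of_edges (by rw [ne_eq, ← NNReal.coe_eq_zero]; exact hKpos.ne')
        fun e => LipschitzOnWith.of_dist_le_mul fun s hs t ht => ?_
      obtain ⟨g, -, hg, -, hb⟩ := h.exists_deriv_representative hc hlen hw hf' e
      rw [dist_eq_norm, hg t ht s hs, dist_eq_norm, Real.norm_eq_abs]
      refine intervalIntegral.norm_integral_le_of_norm_le_const fun τ hτ => ?_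
      refine (hb τ (uIcc_subset_Icc ht hs (uIoc_subset_uIcc hτ))).trans ?_
      refine le_trans ?_ (le_add_of_nonneg_right hε.le)
      gcongr
    have := dist_le_mul_d hconn hlip x y
    rwa [dist_eq_norm] at this
  refine le_of_forall_pos_le_add fun ε hε => ?_
  have hd := d_nonneg x y
  refine (key (ε / (G.d x y + 1)) (by positivity)).trans ?_
  rw [add_mul]
  gcongr
  rw [div_mul_eq_mul_div, div_le_iff₀ (by positivity)]
  nlinarith

/-- If the second weak derivative has a continuous representative, then the function is twice
differentiable in the classical sense on the open edges. -/
theorem MemW12.exists_hasEdgeDeriv {c : ℝ} (hc : 0 < c)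
    (hlen : ∀ e, c ≤ G.len e) {f f' w : G.Point → ℂ} (h : G.MemW12 f f')
    (hw : MemLp w 2 G.vol) (hf' : G.IsWeakDeriv f' w) (hwc : Continuous w) :
    ∃ k, G.HasEdgeDeriv f k ∧ G.HasEdgeDeriv k w := by
  choose g hgc hfg hgw hgb using h.exists_deriv_representative hc hlen hw hf'
  let k : G.Point → ℂ := fun x => match x with
    | .vertex _ => 0
    | .inner e s _ _ => g e s
  have hk : ∀ e, ∀ s ∈ Ioo 0 (G.len e), k (G.pt e s) = g e s := by
    intro e s hs
    rw [pt_of_mem_Ioo hs]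
  -- the fundamental theorem of calculus for a function given as a primitive
  have hder : ∀ (e : E) {u v : ℝ → ℂ}, ContinuousOn v (Icc 0 (G.len e)) →
      (∀ s ∈ Icc 0 (G.len e), ∀ t ∈ Icc 0 (G.len e), u t - u s = ∫ τ in s..t, v τ) →
      ∀ s ∈ Ioo 0 (G.len e), HasDerivAt u (v s) s := by
    intro e u v hv huv s hs
    have hnhds : Ioo 0 (G.len e) ∈ 𝓝 s := Ioo_mem_nhds hs.1 hs.2
    have h1 : HasDerivAt (fun t => u s + ∫ τ in s..t, v τ) (v s) s := by
      refine (intervalIntegral.integral_hasDerivAt_right (by simp) ?_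
        (hv.continuousAt (Icc_mem_nhds hs.1 hs.2))).const_add _
      exact (hv.mono Ioo_subset_Icc_self).stronglyMeasurableAtFilter isOpen_Ioo s hs
    refine h1.congr_of_eventuallyEq ?_
    filter_upwards [hnhds] with t ht
    rw [← huv s (Ioo_subset_Icc_self hs) t (Ioo_subset_Icc_self ht), add_sub_cancel]
  refine ⟨k, fun e s hs => ?_, fun e s hs => ?_⟩
  · rw [hk e s hs]
    exact hder e (hgc e) (hfg e) s hs
  · have h1 := hder e (hwc.comp (G.lipschitzWith_pt e).continuous).continuousOn (hgw e) s hs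
    refine h1.congr_of_eventuallyEq ?_
    filter_upwards [Ioo_mem_nhds hs.1 hs.2] with t ht
    exact hk e t ht

end MetricGraph

namespace MetricGraph

variable {V E : Type*} {G : MetricGraph V E} {D : Set V}

/-! ### The form domain as a Hilbert space -/

/-- The form domain `W₀^{1,2}(G; D)` as a subspace of `L² × L²`, a function being identified with
the pair of the classes of itself and of its weak derivative. -/
def formSpace (G : MetricGraph V E) (D : Set V) : Submodule ℂ (WithLp 2 (G.L2 × G.L2)) where
  carrier := {z | G.IsWeakDeriv z.fst z.snd ∧
    ∃ f, Continuous f ∧ f =ᵐ[G.vol] z.fst ∧ ∀ v ∈ D, f (Point.vertex v) = 0}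
  zero_mem' := by
    refine ⟨(isWeakDeriv_iff_inner _ _).2 fun e φ h => by simp, fun _ => 0, continuous_const,
      ?_, fun _ _ => rfl⟩
    exact (Lp.coeFn_zero ℂ 2 G.vol).symm
  add_mem' := by
    rintro z w ⟨hz, f, hf, hfz, hfD⟩ ⟨hw, g, hg, hgw, hgD⟩
    refine ⟨(isWeakDeriv_iff_inner _ _).2 fun e φ h => ?_, f + g, hf.add hg, ?_, fun v hv => ?_⟩
    · rw [WithLp.add_fst, WithLp.add_snd, inner_add_right, inner_add_right,
        (isWeakDeriv_iff_inner _ _).1 hz e φ h, (isWeakDeriv_iff_inner _ _).1 hw e φ h, neg_add]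
    · exact (hfz.add hgw).trans (Lp.coeFn_add _ _).symm
    · simp [hfD v hv, hgD v hv]
  smul_mem' := by
    rintro a z ⟨hz, f, hf, hfz, hfD⟩
    refine ⟨(isWeakDeriv_iff_inner _ _).2 fun e φ h => ?_, a • f, hf.const_smul a, ?_,
      fun v hv => ?_⟩
    · rw [WithLp.smul_fst, WithLp.smul_snd, inner_smul_right, inner_smul_right,
        (isWeakDeriv_iff_inner _ _).1 hz e φ h, mul_neg]
    · exact (hfz.const_smul a).trans (Lp.coeFn_smul _ _).symm
    · simp [hfD v hv]

theorem memFormDomain_of_mem_formSpace {z : WithLp 2 (G.L2 × G.L2)} (hz : z ∈ G.formSpace D)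
    {f : G.Point → ℂ} (hf : Continuous f) (hfz : f =ᵐ[G.vol] z.fst)
    (hfD : ∀ v ∈ D, f (Point.vertex v) = 0) : G.MemFormDomain D f z.snd where
  continuous := hf
  memLp := (memLp_congr_ae hfz).2 (Lp.memLp _)
  memLp_deriv := Lp.memLp _
  isWeakDeriv := hz.1.congr_ae hfz.symm EventuallyEq.rfl
    ((memLp_congr_ae hfz).2 (Lp.memLp _)) (Lp.memLp _)
  dirichlet := hfD

theorem MemFormDomain.toLp_mem_formSpace {f f' : G.Point → ℂ} (h : G.MemFormDomain D f f') :
    WithLp.toLp 2 (h.memLp.toLp f, h.memLp_deriv.toLp f') ∈ G.formSpace D :=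
  ⟨h.isWeakDeriv.congr_ae h.memLp.coeFn_toLp.symm h.memLp_deriv.coeFn_toLp.symm
    (Lp.memLp _) (Lp.memLp _), f, h.continuous, h.memLp.coeFn_toLp.symm, h.dirichlet⟩

theorem ae_vol_eq_bot [IsEmpty E] : ae G.vol = ⊥ := by
  rw [vol, Measure.sum_of_isEmpty, ae_zero]

/-- The Sobolev inequality: point evaluations are bounded on the form domain. -/
theorem norm_le_mul_norm_of_mem_formSpace (hconn : G.IsConnected) [Nonempty E] {c : ℝ}
    (hc : 0 < c) (hlen : ∀ e, c ≤ G.len e) {z : WithLp 2 (G.L2 × G.L2)}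
    (hz : z ∈ G.formSpace ∅) {f : G.Point → ℂ} (hf : Continuous f) (hfz : f =ᵐ[G.vol] z.fst)
    (x : G.Point) : ‖f x‖ ≤ (c⁻¹ + 1) * √c * 2 * ‖z‖ := by
  have h := memFormDomain_of_mem_formSpace hz hf hfz (by simp)
  refine (h.norm_le hconn hc hlen x).trans ?_
  rw [eLpNorm_congr_ae hfz, ← Lp.norm_def, ← Lp.norm_def, mul_assoc _ (2 : ℝ)]
  gcongr
  linarith [WithLp.norm_fst_le _ z, WithLp.norm_snd_le _ z]

theorem formSpace_le_formSpace_empty : G.formSpace D ≤ G.formSpace ∅ := by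
  rintro z ⟨hz, f, hf, hfz, -⟩
  exact ⟨hz, f, hf, hfz, by simp⟩

/-- The form domain is complete: by the Sobolev inequality, convergence in it is uniform. -/
theorem isClosed_formSpace (hconn : G.IsConnected) (hlen : G.LengthsBoundedBelow) :
    IsClosed (G.formSpace D : Set (WithLp 2 (G.L2 × G.L2))) := by
  obtain ⟨c, hc, hlen⟩ := hlen
  refine IsSeqClosed.isClosed fun z z₀ hz hlim => ?_
  have hfst : Tendsto (fun n => (z n).fst) atTop (𝓝 z₀.fst) :=
    ((WithLp.fstL 2 ℂ G.L2 G.L2).continuous.tendsto z₀).comp hlim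
  have hsnd : Tendsto (fun n => (z n).snd) atTop (𝓝 z₀.snd) :=
    ((WithLp.sndL 2 ℂ G.L2 G.L2).continuous.tendsto z₀).comp hlim
  refine ⟨(isWeakDeriv_iff_inner _ _).2 fun e φ h => ?_, ?_⟩
  · refine tendsto_nhds_unique (tendsto_const_nhds.inner hfst)
      ((tendsto_const_nhds.inner hsnd).neg.congr fun n => ?_)
    exact ((isWeakDeriv_iff_inner _ _).1 (hz n).1 e φ h).symm
  rcases isEmpty_or_nonempty E with hE | hE
  · exact ⟨fun _ => 0, continuous_const, by rw [ae_vol_eq_bot]; exact Filter.eventually_bot,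
      fun _ _ => rfl⟩
  choose f hf hfz hfD using fun n => (hz n).2
  set K := (c⁻¹ + 1) * √c * 2 with hK
  have hK0 : 0 ≤ K := by positivity
  have hdist : ∀ n m x, dist (f n x) (f m x) ≤ K * dist (z n) (z m) := by
    intro n m x
    rw [dist_eq_norm, dist_eq_norm]
    refine norm_le_mul_norm_of_mem_formSpace (f := f n - f m) hconn hc hlen
      (formSpace_le_formSpace_empty ((G.formSpace D).sub_mem (hz n) (hz m)))
      ((hf n).sub (hf m)) ?_ x
    rw [WithLp.sub_fst]
    exact ((hfz n).sub (hfz m)).trans (Lp.coeFn_sub _ _).symm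
  have hcau : ∀ ε > 0, ∃ N, ∀ n ≥ N, ∀ m ≥ N, ∀ x, dist (f n x) (f m x) < ε := by
    intro ε hε
    obtain ⟨N, hN⟩ := Metric.cauchySeq_iff.1 hlim.cauchySeq (ε / (K + 1)) (by positivity)
    refine ⟨N, fun n hn m hm x => (hdist n m x).trans_lt ?_⟩
    have h1 := hN n hn m hm
    rw [lt_div_iff₀ (by positivity)] at h1
    nlinarith [dist_nonneg (x := z n) (y := z m)]
  have hpt : ∀ x, ∃ y, Tendsto (fun n => f n x) atTop (𝓝 y) := fun x =>
    cauchySeq_tendsto_of_complete (Metric.cauchySeq_iff.2 fun ε hε => by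
      obtain ⟨N, hN⟩ := hcau ε hε
      exact ⟨N, fun n hn m hm => hN n hn m hm x⟩)
  choose f₀ hf₀ using hpt
  have hunif : TendstoUniformly f f₀ atTop := by
    rw [← tendstoUniformlyOn_univ]
    refine UniformCauchySeqOn.tendstoUniformlyOn_of_tendsto ?_ fun x _ => hf₀ x
    rw [Metric.uniformCauchySeqOn_iff]
    intro ε hε
    obtain ⟨N, hN⟩ := hcau ε hε
    exact ⟨N, fun n hn m hm x _ => hN n hn m hm x⟩
  refine ⟨f₀, hunif.continuous (Frequently.of_forall hf), ?_, fun v hv => ?_⟩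
  · have hmeas : TendstoInMeasure G.vol (fun n => ((z n).fst : G.Point → ℂ)) atTop z₀.fst :=
      tendstoInMeasure_of_tendsto_Lp hfst
    obtain ⟨ns, hns, hae⟩ := hmeas.exists_seq_tendsto_ae
    filter_upwards [hae, ae_all_iff.2 hfz] with x hx hx2
    refine tendsto_nhds_unique ((hf₀ x).comp hns.tendsto_atTop) (hx.congr fun n => ?_)
    exact (hx2 (ns n)).symm
  · refine tendsto_nhds_unique (hf₀ _) ?_
    simp only [hfD _ v hv]
    exact tendsto_const_nhds

/-- The inclusion of the form domain into `L²`. -/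
noncomputable def formEmbedding (G : MetricGraph V E) (D : Set V) : G.formSpace D →L[ℂ] G.L2 :=
  WithLp.fstL 2 ℂ G.L2 G.L2 ∘L (G.formSpace D).subtypeL

theorem formEmbedding_apply (z : G.formSpace D) :
    G.formEmbedding D z = (z : WithLp 2 (G.L2 × G.L2)).fst := rfl

theorem inner_formSpace (z w : G.formSpace D) :
    ⟪z, w⟫_ℂ = ⟪(z : WithLp 2 (G.L2 × G.L2)).fst, (w : WithLp 2 (G.L2 × G.L2)).fst⟫_ℂ +
      ⟪(z : WithLp 2 (G.L2 × G.L2)).snd, (w : WithLp 2 (G.L2 × G.L2)).snd⟫_ℂ := rfl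

/-- A continuous representative that vanishes on `D` of an element of the form domain. -/
theorem exists_representative (z : G.formSpace D) :
    ∃ f, Continuous f ∧ f =ᵐ[G.vol] G.formEmbedding D z ∧ ∀ v ∈ D, f (Point.vertex v) = 0 :=
  z.2.2

/-- Point evaluation on the form domain, by means of the continuous representative. -/
theorem exists_inner_eq_eval (hconn : G.IsConnected) [Nonempty E] (hlen : G.LengthsBoundedBelow)
    [CompleteSpace (G.formSpace D)] (x : G.Point) :
    ∃ δ : G.formSpace D, ∀ (z : G.formSpace D) (f : G.Point → ℂ), Continuous f →
      f =ᵐ[G.vol] G.formEmbedding D z → ⟪δ, z⟫_ℂ = f x := by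
  obtain ⟨c, hc, hlen⟩ := hlen
  choose f hf hfz hfD using exists_representative (G := G) (D := D)
  have huniq : ∀ z (g : G.Point → ℂ), Continuous g → g =ᵐ[G.vol] G.formEmbedding D z → f z = g :=
    fun z g hg hgz => eq_of_ae_eq hconn (hf z) hg ((hfz z).trans hgz.symm)
  let ev : G.formSpace D →ₗ[ℂ] ℂ :=
    { toFun := fun z => f z x
      map_add' := fun z w => by
        rw [huniq (z + w) (f z + f w) ((hf z).add (hf w))]
        · rfl
        · rw [map_add]
          exact ((hfz z).add (hfz w)).trans (Lp.coeFn_add _ _).symm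
      map_smul' := fun a z => by
        rw [huniq (a • z) (a • f z) ((hf z).const_smul a)]
        · rfl
        · rw [map_smul]
          exact ((hfz z).const_smul a).trans (Lp.coeFn_smul _ _).symm }
  let evL : StrongDual ℂ (G.formSpace D) := ev.mkContinuous ((c⁻¹ + 1) * √c * 2) fun z =>
    norm_le_mul_norm_of_mem_formSpace hconn hc hlen (formSpace_le_formSpace_empty z.2)
      (hf z) (hfz z) x
  refine ⟨(InnerProductSpace.toDual ℂ _).symm evL, fun z g hg hgz => ?_⟩
  rw [InnerProductSpace.toDual_symm_apply, ← huniq z g hg hgz]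
  rfl

/-! ### The resolvent and its kernel -/

/-- `R = (1 - Δ)⁻¹`, and `r x ∈ L²(G)` is the complex conjugate of its integral kernel at `x`, that
is `(R v)(x) = ⟪r x, v⟫` for the continuous representative of `R v`. The kernel is bounded by `C`
and Lipschitz continuous in `x` with constant `C`, in the norm of `L²(G)`. -/
structure IsResolventKernel (G : MetricGraph V E) (D : Set V) (R : G.L2 →L[ℂ] G.L2)
    (r : G.Point → G.L2) (C : ℝ) : Prop where
  pos : 0 < C
  isPositive : R.IsPositive
  injective : ∀ v, R v = 0 → v = 0
  isLaplacian_iff : ∀ u w : G.L2, G.IsLaplacian D u w ↔ R (u - w) = u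
  norm_le : ∀ x, ‖r x‖ ≤ C
  norm_sub_le : ∀ x y, ‖r x - r y‖ ≤ C * G.d x y
  ae_eq : ∀ v, (fun y => ⟪r y, v⟫_ℂ) =ᵐ[G.vol] R v
  exists_deriv : ∀ v, ∃ g : G.L2, G.MemFormDomain D (fun y => ⟪r y, v⟫_ℂ) g ∧
    G.IsWeakDeriv g (R v - v : G.L2) ∧ ‖R v‖ ^ 2 + ‖g‖ ^ 2 = (⟪v, R v⟫_ℂ).re

theorem eq_zero_of_inner_edgeExtend_eq_zero [Countable E] {v : G.L2}
    (h : ∀ e φ (hφ : IsTestFunction (G.len e) φ),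
      ⟪(hφ.memLp_edgeExtend 2).toLp _, v⟫_ℂ = 0) : v = 0 := by
  refine (Lp.eq_zero_iff_ae_eq_zero).2 (ae_of_ae_pt ?_ fun e => ?_)
  · exact (Lp.stronglyMeasurable v).measurable (measurableSet_singleton 0)
  · rw [ae_restrict_iff' measurableSet_Ioo]
    refine isOpen_Ioo.ae_eq_zero_of_integral_contDiff_smul_eq_zero
      (locallyIntegrableOn_comp_pt (Lp.memLp v) e) fun ψ hψ hψc hψs => ?_
    have hφ : IsTestFunction (G.len e) (fun s => (ψ s : ℂ)) :=
      ⟨Complex.ofRealCLM.contDiff.comp hψ,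
        hψc.comp_left (g := fun r : ℝ => (r : ℂ)) Complex.ofReal_zero,
        (tsupport_comp_subset (g := fun r : ℝ => (r : ℂ)) Complex.ofReal_zero ψ).trans hψs⟩
    have h1 := h e _ hφ
    rw [inner_edgeExtend hφ] at h1
    rw [← setIntegral_eq_integral_of_forall_compl_eq_zero (s := Ioo 0 (G.len e)), ← h1]
    · congr 1
      funext s
      rw [Complex.conj_ofReal, Complex.real_smul, mul_comm]
    · intro s hs
      rw [image_eq_zero_of_notMem_tsupport fun h => hs (hψs h), zero_smul]

section Resolvent

variable [CompleteSpace (G.formSpace D)]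

/-- The solution in the form domain of the equation `u - Δ u = v`, which is given by the Riesz
representation theorem. -/
noncomputable def formSolution (G : MetricGraph V E) (D : Set V) [CompleteSpace (G.formSpace D)] :
    G.L2 →L[ℂ] G.formSpace D :=
  ContinuousLinearMap.adjoint (G.formEmbedding D)

/-- The resolvent `(1 - Δ)⁻¹` on `L²(G)`. -/
noncomputable def resolvent (G : MetricGraph V E) (D : Set V) [CompleteSpace (G.formSpace D)] :
    G.L2 →L[ℂ] G.L2 :=
  G.formEmbedding D ∘L G.formSolution D

/-- The class of the weak derivative of `(1 - Δ)⁻¹ v`. -/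
noncomputable def resolventDeriv (G : MetricGraph V E) (D : Set V) [CompleteSpace (G.formSpace D)]
    (v : G.L2) : G.L2 :=
  (G.formSolution D v : WithLp 2 (G.L2 × G.L2)).snd

theorem isPositive_resolvent : (G.resolvent D).IsPositive :=
  ContinuousLinearMap.isPositive_self_comp_adjoint (G.formEmbedding D)

/-- The weak formulation of `u - Δ u = v`. -/
theorem inner_resolvent_add_inner_resolventDeriv (v : G.L2) {h h' : G.Point → ℂ}
    (hh : G.MemFormDomain D h h') :
    ⟪hh.memLp.toLp h, G.resolvent D v⟫_ℂ + ⟪hh.memLp_deriv.toLp h', G.resolventDeriv D v⟫_ℂ =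
      ⟪hh.memLp.toLp h, v⟫_ℂ :=
  ContinuousLinearMap.adjoint_inner_right (G.formEmbedding D) ⟨_, hh.toLp_mem_formSpace⟩ v

theorem norm_sq_resolvent_add (v : G.L2) :
    ‖G.resolvent D v‖ ^ 2 + ‖G.resolventDeriv D v‖ ^ 2 = (⟪v, G.resolvent D v⟫_ℂ).re := by
  have h1 := ContinuousLinearMap.adjoint_inner_left (G.formEmbedding D) (G.formSolution D v) v
  change ⟪G.formSolution D v, _⟫_ℂ = _ at h1
  rw [inner_formSpace, inner_self_eq_norm_sq_to_K, inner_self_eq_norm_sq_to_K] at h1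
  have h2 := congrArg Complex.re h1
  simp only [Complex.coe_algebraMap, Complex.add_re, ← Complex.ofReal_pow,
    Complex.ofReal_re] at h2
  exact h2

theorem norm_resolvent_le (v : G.L2) :
    ‖G.resolvent D v‖ ≤ ‖v‖ ∧ ‖G.resolventDeriv D v‖ ≤ ‖v‖ := by
  have h1 := norm_sq_resolvent_add (D := D) v
  have h2 : (⟪v, G.resolvent D v⟫_ℂ).re ≤ ‖v‖ * ‖G.resolvent D v‖ :=
    re_inner_le_norm (𝕜 := ℂ) v (G.resolvent D v)
  have h3 := norm_nonneg v
  have h4 := norm_nonneg (G.resolvent D v)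
  have h5 := norm_nonneg (G.resolventDeriv D v)
  have h6 : ‖G.resolvent D v‖ ≤ ‖v‖ := by nlinarith
  exact ⟨h6, by nlinarith⟩

theorem isWeakDeriv_resolventDeriv (v : G.L2) :
    G.IsWeakDeriv (G.resolventDeriv D v) (G.resolvent D v - v : G.L2) := by
  refine (isWeakDeriv_iff_inner _ _).2 fun e φ h => ?_
  have h1 := inner_resolvent_add_inner_resolventDeriv v (h.memFormDomain (D := D))
  rw [inner_sub_right, ← h1]
  ring

/-- The resolvent is injective, because the form domain contains the test functions on the edges
and is therefore dense in `L²(G)`. -/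
theorem resolvent_injective [Countable E] (v : G.L2) (hv : G.resolvent D v = 0) : v = 0 := by
  have h1 := norm_sq_resolvent_add (D := D) v
  rw [hv, inner_zero_right, norm_zero, Complex.zero_re] at h1
  have h2 : G.resolventDeriv D v = 0 := by
    rw [← norm_eq_zero, ← sq_eq_zero_iff]; linarith
  refine eq_zero_of_inner_edgeExtend_eq_zero fun e φ hφ => ?_
  have h3 := inner_resolvent_add_inner_resolventDeriv v (hφ.memFormDomain (D := D))
  rw [hv, h2, inner_zero_right, inner_zero_right, add_zero] at h3
  exact h3.symm

theorem inner_toLp_eq {h : G.Point → ℂ} (hh : MemLp h 2 G.vol) (w : G.L2) :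
    ⟪hh.toLp h, w⟫_ℂ = ∫ x, w x * conj (h x) ∂G.vol := by
  rw [L2.inner_def]
  refine integral_congr_ae ?_
  filter_upwards [hh.coeFn_toLp] with x hx
  rw [hx, RCLike.inner_apply]

theorem resolvent_eq_of_isLaplacian {u w : G.L2} (h : G.IsLaplacian D u w) :
    G.resolvent D (u - w) = u := by
  obtain ⟨-, f₀, f', huf, hm, hw⟩ := h
  have hu : hm.memLp.toLp f₀ = u := Lp.ext (hm.memLp.coeFn_toLp.trans huf.symm)
  let ζ : G.formSpace D := ⟨_, hm.toLp_mem_formSpace⟩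
  have hζ : G.formSolution D (u - w) = ζ := by
    refine ext_inner_left ℂ fun η => ?_
    obtain ⟨h, hh, hhη, hhD⟩ := exists_representative η
    have hmη := memFormDomain_of_mem_formSpace η.2 hh hhη hhD
    have h1 := hw _ _ hmη
    have e1 : ⟪(η : WithLp 2 (G.L2 × G.L2)).snd, hm.memLp_deriv.toLp f'⟫_ℂ =
        ∫ x, f' x * conj ((η : WithLp 2 (G.L2 × G.L2)).snd x) ∂G.vol := by
      rw [L2.inner_def]
      refine integral_congr_ae ?_
      filter_upwards [hm.memLp_deriv.coeFn_toLp] with x hx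
      rw [hx, RCLike.inner_apply]
    have e2 : ⟪(η : WithLp 2 (G.L2 × G.L2)).fst, w⟫_ℂ = ∫ x, w x * conj (h x) ∂G.vol := by
      rw [L2.inner_def]
      refine integral_congr_ae ?_
      filter_upwards [hhη] with x hx
      rw [hx, RCLike.inner_apply, formEmbedding_apply]
    rw [formSolution, ContinuousLinearMap.adjoint_inner_right, inner_sub_right, inner_formSpace]
    change ⟪(η : WithLp 2 (G.L2 × G.L2)).fst, u⟫_ℂ - ⟪(η : WithLp 2 (G.L2 × G.L2)).fst, w⟫_ℂ =
      ⟪(η : WithLp 2 (G.L2 × G.L2)).fst, hm.memLp.toLp f₀⟫_ℂ +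
        ⟪(η : WithLp 2 (G.L2 × G.L2)).snd, hm.memLp_deriv.toLp f'⟫_ℂ
    rw [hu, e1, h1, e2, sub_eq_add_neg]
  rw [resolvent, ContinuousLinearMap.comp_apply, hζ]
  exact hu

theorem isLaplacian_of_resolvent_eq {u w : G.L2} (h : G.resolvent D (u - w) = u) :
    G.IsLaplacian D u w := by
  obtain ⟨f, hf, hfζ, hfD⟩ := exists_representative (G.formSolution D (u - w))
  have hm := memFormDomain_of_mem_formSpace (G.formSolution D (u - w)).2 hf hfζ hfD
  have hfu : f =ᵐ[G.vol] u := by rw [← h]; exact hfζ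
  refine ⟨Lp.memLp w, f, _, hfu.symm, hm, fun h₀ h₀' hh => ?_⟩
  have h1 := inner_resolvent_add_inner_resolventDeriv (u - w) hh
  rw [h, inner_sub_right (𝕜 := ℂ) (hh.memLp.toLp h₀) u w, sub_eq_add_neg (⟪_, u⟫_ℂ),
    add_right_inj, inner_toLp_eq hh.memLp_deriv, inner_toLp_eq hh.memLp] at h1
  exact h1

/-- The Riesz representation theorem applied to the point evaluations on the form domain gives the
integral kernel of the resolvent. -/
theorem exists_kernel_resolvent (hconn : G.IsConnected) (hlen : G.LengthsBoundedBelow) :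
    ∃ r : G.Point → G.L2, ∀ v, (fun y => ⟪r y, v⟫_ℂ) =ᵐ[G.vol] G.resolvent D v ∧
      G.MemFormDomain D (fun y => ⟪r y, v⟫_ℂ) (G.resolventDeriv D v) := by
  rcases isEmpty_or_nonempty E with hE | hE
  · refine ⟨fun _ => 0, fun v => ⟨?_, ?_⟩⟩
    · rw [ae_vol_eq_bot]; exact Filter.eventually_bot
    · simp only [inner_zero_left]
      exact ⟨⟨continuous_const, by simp, Lp.memLp _, fun e => isEmptyElim e⟩, fun _ _ => rfl⟩
  choose δ hδ using exists_inner_eq_eval (D := D) hconn hlen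
  refine ⟨fun y => G.formEmbedding D (δ y), fun v => ?_⟩
  obtain ⟨f, hf, hfv, hfD⟩ := exists_representative (G.formSolution D v)
  have h : (fun y => ⟪G.formEmbedding D (δ y), v⟫_ℂ) = f := by
    funext y
    rw [← ContinuousLinearMap.adjoint_inner_right]
    exact hδ y _ f hf hfv
  rw [h]
  exact ⟨hfv, memFormDomain_of_mem_formSpace (G.formSolution D v).2 hf hfv hfD⟩

end Resolvent

theorem norm_le_of_forall_norm_inner_le {H : Type*} [NormedAddCommGroup H] [InnerProductSpace ℂ H]
    {a : H} {M : ℝ} (hM : 0 ≤ M) (h : ∀ v, ‖⟪a, v⟫_ℂ‖ ≤ M * ‖v‖) : ‖a‖ ≤ M := by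
  have h1 := h a
  rw [inner_self_eq_norm_sq_to_K, norm_pow] at h1
  simp only [Complex.coe_algebraMap, Complex.norm_real, norm_norm] at h1
  rcases (norm_nonneg a).eq_or_lt with h0 | h0
  · rwa [← h0]
  · nlinarith

theorem exists_isResolventKernel (hconn : G.IsConnected) (hfin : G.LocallyFinite)
    (hlen : G.LengthsBoundedBelow) (D : Set V) :
    ∃ R r C, G.IsResolventKernel D R r C := by
  have := countable_edges hconn hfin
  have : CompleteSpace (G.formSpace D) := (isClosed_formSpace hconn hlen).completeSpace_coe
  obtain ⟨r, hr⟩ := exists_kernel_resolvent (D := D) hconn hlen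
  obtain ⟨c, hc, hlen⟩ := hlen
  set K := (c⁻¹ + 1) * √c with hK
  have hK0 : 0 < K := by positivity
  rcases isEmpty_or_nonempty E with hE | hE
  · have hsub : Subsingleton G.L2 := ⟨fun u v => Lp.ext (by
      rw [ae_vol_eq_bot]; exact Filter.eventually_bot)⟩
    refine ⟨G.resolvent D, r, 1, one_pos, isPositive_resolvent, resolvent_injective,
      fun u w => ⟨resolvent_eq_of_isLaplacian, isLaplacian_of_resolvent_eq⟩,
      fun x => ?_, fun x y => ?_, fun v => (hr v).1,
      fun v => ⟨_, (hr v).2, isWeakDeriv_resolventDeriv v, norm_sq_resolvent_add v⟩⟩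
    · rw [Subsingleton.elim (r x) 0, norm_zero]; exact zero_le_one
    · rw [Subsingleton.elim (r x - r y) 0, norm_zero, one_mul]; exact d_nonneg x y
  refine ⟨G.resolvent D, r, K * 3, by positivity, isPositive_resolvent, resolvent_injective,
    fun u w => ⟨resolvent_eq_of_isLaplacian, isLaplacian_of_resolvent_eq⟩,
    fun x => ?_, fun x y => ?_, fun v => (hr v).1,
    fun v => ⟨_, (hr v).2, isWeakDeriv_resolventDeriv v, norm_sq_resolvent_add v⟩⟩
  -- the bounds on the kernel are dual to those on the continuous representatives
  · refine norm_le_of_forall_norm_inner_le (by positivity) fun v => ?_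
    refine ((hr v).2.norm_le hconn hc hlen x).trans ?_
    obtain ⟨h1, h2⟩ := norm_resolvent_le (D := D) v
    rw [eLpNorm_congr_ae (hr v).1, ← Lp.norm_def, ← Lp.norm_def, ← hK]
    calc _ ≤ K * (3 * ‖v‖) :=
          mul_le_mul_of_nonneg_left (by linarith [norm_nonneg v]) hK0.le
      _ = _ := by ring
  · have hd := d_nonneg x y
    refine norm_le_of_forall_norm_inner_le (by positivity) fun v => ?_
    obtain ⟨h1, h2⟩ := norm_resolvent_le (D := D) v
    rw [inner_sub_left]
    refine ((hr v).2.norm_sub_le_mul_d hconn hc hlen (Lp.memLp (G.resolvent D v - v))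
      (isWeakDeriv_resolventDeriv v) (M := 3 * ‖v‖) ?_ x y).trans_eq (by rw [← hK]; ring)
    rw [← Lp.norm_def, ← Lp.norm_def]
    linarith [norm_sub_le (G.resolvent D v) v]

end MetricGraph

/-! ### Uniqueness of integral kernels -/

/-- Two measurable integral kernels that define the same operator on `L²` agree a.e. -/
theorem ae_eq_of_integral_kernel_eq {α : Type*} [MeasurableSpace α]
    [MeasurableSpace.CountablyGenerated α] {μ : Measure α} [SigmaFinite μ] {k k' : α → α → ℂ}
    (hk : Measurable (Function.uncurry k)) (hk' : Measurable (Function.uncurry k'))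
    (h : ∀ u : Lp ℂ 2 μ, ∀ᵐ x ∂μ, Integrable (fun y => k x y * u y) μ ∧
      Integrable (fun y => k' x y * u y) μ ∧ ∫ y, k x y * u y ∂μ = ∫ y, k' x y * u y ∂μ) :
    Function.uncurry k =ᵐ[μ.prod μ] Function.uncurry k' := by
  -- a countable algebra of sets that generates the measurable space
  set A := generateSetAlgebra (MeasurableSpace.countableGeneratingSet α) with hA
  have hAalg : IsSetAlgebra A := isSetAlgebra_generateSetAlgebra
  have hAc : A.Countable :=
    countable_generateSetAlgebra MeasurableSpace.countable_countableGeneratingSet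
  have hAgen : ‹MeasurableSpace α› = MeasurableSpace.generateFrom A := by
    rw [hA, generateFrom_generateSetAlgebra_eq,
      MeasurableSpace.generateFrom_countableGeneratingSet]
  have hAm : ∀ B ∈ A, MeasurableSet B := fun B hB => by
    rw [hAgen]; exact MeasurableSpace.measurableSet_generateFrom hB
  have : Countable A := hAc.to_subtype
  have key : ∀ (n : ℕ) (B : A), ∀ᵐ x ∂μ,
      IntegrableOn (k x) (B ∩ spanningSets μ n) μ ∧ IntegrableOn (k' x) (B ∩ spanningSets μ n) μ ∧
        ∫ y in B ∩ spanningSets μ n, k x y ∂μ = ∫ y in B ∩ spanningSets μ n, k' x y ∂μ := by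
    rintro n ⟨B, hB⟩
    have hm : MeasurableSet (B ∩ spanningSets μ n) :=
      (hAm B hB).inter (measurableSet_spanningSets μ n)
    have hfin : μ (B ∩ spanningSets μ n) ≠ ⊤ :=
      ((measure_mono inter_subset_right).trans_lt (measure_spanningSets_lt_top μ n)).ne
    have hu := indicatorConstLp_coeFn (p := 2) (hs := hm) (hμs := hfin) (c := (1 : ℂ))
    have e : ∀ g : α → ℂ, (fun y => g y * indicatorConstLp 2 hm hfin (1 : ℂ) y) =ᵐ[μ]
        (B ∩ spanningSets μ n).indicator g := by
      intro g
      filter_upwards [hu] with y hy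
      rw [hy]
      by_cases hy : y ∈ B ∩ spanningSets μ n <;> simp only [indicator, hy, if_true, if_false,
        mul_one, mul_zero]
    filter_upwards [h (indicatorConstLp 2 hm hfin (1 : ℂ))] with x hx
    rw [integrable_congr (e _), integrable_congr (e _), integral_congr_ae (e _),
      integral_congr_ae (e _), integrable_indicator_iff hm, integrable_indicator_iff hm,
      integral_indicator hm, integral_indicator hm] at hx
    exact hx
  have hmeas : MeasurableSet {z : α × α | Function.uncurry k z = Function.uncurry k' z} :=
    measurableSet_eq_fun hk hk'
  refine (Measure.ae_prod_iff_ae_ae hmeas).2 ?_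
  filter_upwards [ae_all_iff.2 fun n => ae_all_iff.2 (key n)] with x hx
  have hn : ∀ n, ∀ᵐ y ∂μ.restrict (spanningSets μ n), k x y = k' x y := by
    intro n
    have hint := hx n ⟨univ, hAalg.univ_mem⟩
    rw [univ_inter] at hint
    refine Integrable.ae_eq_of_withDensityᵥ_eq hint.1 hint.2.1 ?_
    refine VectorMeasure.ext_of_generateFrom A (fun B hB => ?_) hAgen
      (fun s hs t ht _ => hAalg.inter_mem hs ht) ?_
    · rw [withDensityᵥ_apply hint.1 (hAm B hB), withDensityᵥ_apply hint.2.1 (hAm B hB),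
        Measure.restrict_restrict (hAm B hB)]
      exact (hx n ⟨B, hB⟩).2.2
    · rw [withDensityᵥ_apply hint.1 MeasurableSet.univ,
        withDensityᵥ_apply hint.2.1 MeasurableSet.univ, Measure.restrict_univ]
      exact hint.2.2
  have hall := (ae_restrict_iUnion_iff (μ := μ) (spanningSets μ) (fun y => k x y = k' x y)).2 hn
  rwa [iUnion_spanningSets, Measure.restrict_univ] at hall

namespace MetricGraph

variable {V E : Type*} {G : MetricGraph V E} {D : Set V}

theorem IsLaplacian.congr_ae {f f₁ w w₁ : G.Point → ℂ} (h : G.IsLaplacian D f w)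
    (hf : f =ᵐ[G.vol] f₁) (hw : w =ᵐ[G.vol] w₁) : G.IsLaplacian D f₁ w₁ := by
  obtain ⟨hm, f₀, f', hf₀, hd, hweak⟩ := h
  refine ⟨(memLp_congr_ae hw).1 hm, f₀, f', hf.symm.trans hf₀, hd, fun h h' hh => ?_⟩
  rw [hweak h h' hh]
  congr 1
  exact integral_congr_ae (hw.mono fun x hx => by simp only [hx])

theorem w22Norm_le {f f' f'' : G.Point → ℂ} (h : G.IsWeakDeriv f f') (h' : G.IsWeakDeriv f' f'') :
    G.w22Norm f ≤
      (eLpNorm f 2 G.vol ^ 2 + eLpNorm f' 2 G.vol ^ 2 + eLpNorm f'' 2 G.vol ^ 2) ^ (1 / 2 : ℝ) :=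
  iInf₂_le_of_le f' f'' (iInf₂_le_of_le h h' le_rfl)

namespace IsResolventKernel

variable {R : G.L2 →L[ℂ] G.L2} {r : G.Point → G.L2} {C : ℝ}

theorem norm_le_one (h : G.IsResolventKernel D R r C) : ‖R‖ ≤ 1 := by
  refine R.opNorm_le_bound zero_le_one fun v => ?_
  obtain ⟨g, -, -, hg⟩ := h.exists_deriv v
  have h2 : (⟪v, R v⟫_ℂ).re ≤ ‖v‖ * ‖R v‖ := re_inner_le_norm (𝕜 := ℂ) v (R v)
  nlinarith [norm_nonneg v, norm_nonneg (R v), sq_nonneg ‖g‖]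

theorem isSelfAdjoint (h : G.IsResolventKernel D R r C) : IsSelfAdjoint R :=
  h.isPositive.isSelfAdjoint

theorem isHeatSemigroup (h : G.IsResolventKernel D R r C) :
    G.IsHeatSemigroup D (heatSemigroup R) where
  zero := heatSemigroup_zero
  add _ _ hs ht := heatSemigroup_add hs ht
  strongly_continuous := continuousOn_heatSemigroup h.isPositive h.norm_le_one h.injective
  generator u w := (h.isLaplacian_iff u w).trans
    (tendsto_slope_heatSemigroup_iff h.isPositive h.norm_le_one h.injective u w).symm

/-- The Laplacian generates only one semigroup. -/
theorem eq_heatSemigroup (h : G.IsResolventKernel D R r C) {T : ℝ → G.L2 →L[ℂ] G.L2}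
    (hT : G.IsHeatSemigroup D T) {t : ℝ} (ht : 0 ≤ t) : T t = heatSemigroup R t := by
  have hS := h.isHeatSemigroup
  refine semigroup_eq_of_generator_eq (A := fun u w : G.L2 => G.IsLaplacian D u w) ?_ ?_
    hT.zero hT.add hT.strongly_continuous hT.generator
    hS.zero hS.add hS.strongly_continuous hS.generator ht
  · intro u u' w w' hu hu'
    rw [h.isLaplacian_iff] at hu hu'
    set v := (u - u') - (w - w') with hv
    have hRv : R v = u - u' := by
      rw [hv, sub_sub_sub_comm, map_sub, hu, hu']
    obtain ⟨g, -, -, hg⟩ := h.exists_deriv v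
    have e : w - w' = R v - v := by rw [hRv, hv]; abel
    rw [← hRv, e, inner_sub_right, inner_self_eq_norm_sq_to_K, ← inner_conj_symm (R v) v]
    simp only [Complex.coe_algebraMap, Complex.sub_re, ← Complex.ofReal_pow, Complex.ofReal_re,
      Complex.conj_re]
    linarith [sq_nonneg ‖g‖]
  · refine (dense_range_of_injective_of_isSelfAdjoint h.isSelfAdjoint h.injective).mono ?_
    rintro _ ⟨v, rfl⟩
    exact ⟨R v - v, (h.isLaplacian_iff _ _).2 (by rw [sub_sub_cancel])⟩

/-! ### Kernels of functions of the resolvent -/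

/-- If `v` and `v₁` satisfy `R v - v = R v₁`, that is `Δ (R v) = R v₁`, then the continuous
representatives of `R v` and `R v₁` inherit this relation. -/
theorem isLaplacian_inner (h : G.IsResolventKernel D R r C) {v v₁ : G.L2}
    (hv : R v - v = R v₁) :
    G.IsLaplacian D (fun y => ⟪r y, v⟫_ℂ) (fun y => ⟪r y, v₁⟫_ℂ) := by
  have h1 : G.IsLaplacian D (R v) (R v₁) := by
    rw [h.isLaplacian_iff, ← hv, sub_sub_cancel]
  exact h1.congr_ae (h.ae_eq v).symm (h.ae_eq v₁).symm

theorem exists_hasEdgeDeriv_inner (h : G.IsResolventKernel D R r C)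
    (hlen : G.LengthsBoundedBelow) {v v₁ : G.L2} (hv : R v - v = R v₁) :
    ∃ k, G.HasEdgeDeriv (fun y => ⟪r y, v⟫_ℂ) k ∧ G.HasEdgeDeriv k (fun y => ⟪r y, v₁⟫_ℂ) := by
  obtain ⟨c, hc, hlen⟩ := hlen
  obtain ⟨g, hg, hgw, -⟩ := h.exists_deriv v
  obtain ⟨g₁, hg₁, -, -⟩ := h.exists_deriv v₁
  refine hg.exists_hasEdgeDeriv hc hlen hg₁.memLp ?_ hg₁.continuous
  exact hgw.congr_ae EventuallyEq.rfl (hv ▸ (h.ae_eq v₁).symm) (Lp.memLp g) hg₁.memLp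

/-- The `W^{2,2}` norm of `R v` is at most `‖v‖`, since `‖f‖² + ‖f'‖² = ⟪v, f⟫` and
`f'' = f - v` for `f = R v`. The statement is about the complex conjugate of `R v`. -/
theorem w22Norm_conj_inner_le (h : G.IsResolventKernel D R r C) (v : G.L2) :
    G.w22Norm (fun y => conj ⟪r y, v⟫_ℂ) ≤ ENNReal.ofReal ‖v‖ := by
  obtain ⟨g, hg, hgw, hn⟩ := h.exists_deriv v
  refine (w22Norm_le hg.isWeakDeriv.star hgw.star).trans ?_
  have hconj : ∀ f : G.Point → ℂ, eLpNorm (fun x => conj (f x)) 2 G.vol = eLpNorm f 2 G.vol :=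
    fun f => eLpNorm_conj f 2 G.vol
  rw [hconj, hconj, hconj, eLpNorm_congr_ae (h.ae_eq v)]
  have e : ∀ u : G.L2, eLpNorm u 2 G.vol = ENNReal.ofReal ‖u‖ := fun u => by
    rw [Lp.norm_def, ENNReal.ofReal_toReal (Lp.eLpNorm_ne_top u)]
  rw [e, e, e, ← ENNReal.ofReal_pow (norm_nonneg _), ← ENNReal.ofReal_pow (norm_nonneg _),
    ← ENNReal.ofReal_pow (norm_nonneg _), ← ENNReal.ofReal_add (by positivity) (by positivity),
    ← ENNReal.ofReal_add (by positivity) (by positivity),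
    ENNReal.ofReal_rpow_of_nonneg (by positivity) (by norm_num)]
  refine ENNReal.ofReal_le_ofReal ?_
  rw [← Real.sqrt_eq_rpow]
  refine Real.sqrt_le_iff.2 ⟨norm_nonneg _, ?_⟩
  have h1 := norm_sub_sq (𝕜 := ℂ) v (R v)
  rw [← norm_neg (v - R v), neg_sub] at h1
  have h2 : RCLike.re ⟪v, R v⟫_ℂ = (⟪v, R v⟫_ℂ).re := rfl
  rw [h2] at h1
  nlinarith [sq_nonneg ‖g‖]

end IsResolventKernel

/-- The integral kernel of the operator `R S R`, if `r` is the kernel of `R`. -/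
noncomputable def sandwichKernel (r : G.Point → G.L2) (S : G.L2 →L[ℂ] G.L2)
    (x y : G.Point) : ℂ :=
  ⟪r x, S (r y)⟫_ℂ

theorem sandwichKernel_eq_conj {r : G.Point → G.L2} {S : G.L2 →L[ℂ] G.L2} (hS : IsSelfAdjoint S)
    (x : G.Point) : sandwichKernel r S x = fun y => conj ⟪r y, S (r x)⟫_ℂ := by
  funext y
  rw [inner_conj_symm, sandwichKernel, ← ContinuousLinearMap.adjoint_inner_left,
    ContinuousLinearMap.isSelfAdjoint_iff'.1 hS]

theorem sandwichKernel_sub_eq_conj {r : G.Point → G.L2} {S : G.L2 →L[ℂ] G.L2}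
    (hS : IsSelfAdjoint S) (x x' : G.Point) :
    sandwichKernel r S x - sandwichKernel r S x' =
      fun y => conj ⟪r y, S (r x - r x')⟫_ℂ := by
  funext y
  rw [Pi.sub_apply, sandwichKernel_eq_conj hS, sandwichKernel_eq_conj hS, map_sub, inner_sub_right,
    map_sub]

theorem HasEdgeDeriv.star {f g : G.Point → ℂ} (h : G.HasEdgeDeriv f g) :
    G.HasEdgeDeriv (fun x => conj (f x)) (fun x => conj (g x)) :=
  fun e s hs => (h e s hs).star

namespace IsResolventKernel

variable {R : G.L2 →L[ℂ] G.L2} {r : G.Point → G.L2} {C : ℝ} {S S₁ : G.L2 →L[ℂ] G.L2}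

theorem norm_apply_sub_le (h : G.IsResolventKernel D R r C) (S : G.L2 →L[ℂ] G.L2)
    (x x' : G.Point) : ‖S (r x - r x')‖ ≤ ‖S‖ * C * G.d x x' := by
  refine (S.le_opNorm _).trans ?_
  rw [mul_assoc]
  exact mul_le_mul_of_nonneg_left (h.norm_sub_le x x') (norm_nonneg S)

theorem jointlyLipschitz (h : G.IsResolventKernel D R r C) (S : G.L2 →L[ℂ] G.L2) :
    G.JointlyLipschitz (sandwichKernel r S) := by
  refine ⟨C * (‖S‖ * C), fun x x' y y' => ?_⟩
  have e : sandwichKernel r S x y - sandwichKernel r S x' y' =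
      ⟪r x - r x', S (r y)⟫_ℂ + ⟪r x', S (r y - r y')⟫_ℂ := by
    rw [sandwichKernel, sandwichKernel, map_sub, inner_sub_left, inner_sub_right]
    ring
  have h1 : ‖⟪r x - r x', S (r y)⟫_ℂ‖ ≤ (C * G.d x x') * (‖S‖ * C) :=
    (norm_inner_le_norm _ _).trans (mul_le_mul (h.norm_sub_le x x')
      ((S.le_opNorm _).trans (mul_le_mul_of_nonneg_left (h.norm_le y) (norm_nonneg S)))
      (norm_nonneg _) (mul_nonneg h.pos.le (d_nonneg x x')))
  have h2 : ‖⟪r x', S (r y - r y')⟫_ℂ‖ ≤ C * (‖S‖ * C * G.d y y') :=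
    (norm_inner_le_norm _ _).trans (mul_le_mul (h.norm_le x') (h.norm_apply_sub_le S y y')
      (norm_nonneg _) h.pos.le)
  rw [e]
  refine (norm_add_le _ _).trans ((add_le_add h1 h2).trans_eq (by ring))

theorem continuous_uncurry (h : G.IsResolventKernel D R r C) (hconn : G.IsConnected)
    (S : G.L2 →L[ℂ] G.L2) : Continuous (Function.uncurry (sandwichKernel r S)) := by
  have hr : Continuous r := by
    refine (LipschitzWith.continuous (K := ⟨C, h.pos.le⟩) fun x y => ?_)
    rw [edist_dist, dist_eq_norm]
    refine (ENNReal.ofReal_le_ofReal (h.norm_sub_le x y)).trans_eq ?_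
    rw [ENNReal.ofReal_mul h.pos.le, d, ENNReal.ofReal_toReal (edist_ne_top hconn x y),
      ENNReal.ofReal_eq_coe_nnreal h.pos.le]
    rfl
  exact (hr.comp continuous_fst).inner (S.continuous.comp (hr.comp continuous_snd))

theorem isLaplacian_sandwichKernel (h : G.IsResolventKernel D R r C) (hS : IsSelfAdjoint S)
    (hS₁ : IsSelfAdjoint S₁) (hSS₁ : R * S - S = R * S₁) (x : G.Point) :
    G.IsLaplacian D (sandwichKernel r S x) (sandwichKernel r S₁ x) := by
  have h1 := (h.isLaplacian_inner (v := S (r x)) (v₁ := S₁ (r x))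
    (congrArg (fun T : G.L2 →L[ℂ] G.L2 => T (r x)) hSS₁)).star
  rwa [sandwichKernel_eq_conj hS, sandwichKernel_eq_conj hS₁]

theorem exists_hasEdgeDeriv_right (h : G.IsResolventKernel D R r C) (hlen : G.LengthsBoundedBelow)
    (hS : IsSelfAdjoint S) (hS₁ : IsSelfAdjoint S₁) (hSS₁ : R * S - S = R * S₁) (x : G.Point) :
    ∃ k, G.HasEdgeDeriv (sandwichKernel r S x) k ∧
      G.HasEdgeDeriv k (sandwichKernel r S₁ x) := by
  obtain ⟨k, h1, h2⟩ := h.exists_hasEdgeDeriv_inner hlen (v := S (r x)) (v₁ := S₁ (r x))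
    (congrArg (fun T : G.L2 →L[ℂ] G.L2 => T (r x)) hSS₁)
  rw [sandwichKernel_eq_conj hS, sandwichKernel_eq_conj hS₁]
  exact ⟨_, h1.star, h2.star⟩

theorem exists_hasEdgeDeriv_left (h : G.IsResolventKernel D R r C) (hlen : G.LengthsBoundedBelow)
    (hSS₁ : R * S - S = R * S₁) (y : G.Point) :
    ∃ k, G.HasEdgeDeriv (fun x => sandwichKernel r S x y) k ∧
      G.HasEdgeDeriv k (fun x => sandwichKernel r S₁ x y) :=
  h.exists_hasEdgeDeriv_inner hlen (v := S (r y)) (v₁ := S₁ (r y))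
    (congrArg (fun T : G.L2 →L[ℂ] G.L2 => T (r y)) hSS₁)

theorem eLpNorm_two_sub_le (h : G.IsResolventKernel D R r C) (hS : IsSelfAdjoint S)
    (x x' : G.Point) : eLpNorm (sandwichKernel r S x - sandwichKernel r S x') 2 G.vol ≤
      ENNReal.ofReal (‖S‖ * C * G.d x x') := by
  rw [sandwichKernel_sub_eq_conj hS,
    show eLpNorm (fun y => conj ⟪r y, S (r x - r x')⟫_ℂ) 2 G.vol = _ from eLpNorm_conj _ 2 G.vol,
    eLpNorm_congr_ae (h.ae_eq _),
    ← ENNReal.ofReal_toReal (Lp.eLpNorm_ne_top _), ← Lp.norm_def]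
  refine ENNReal.ofReal_le_ofReal (((R.le_of_opNorm_le h.norm_le_one _).trans_eq
    (one_mul _)).trans (h.norm_apply_sub_le S x x'))

theorem eLpNorm_top_sub_le (h : G.IsResolventKernel D R r C) (hS : IsSelfAdjoint S)
    (x x' : G.Point) : eLpNorm (sandwichKernel r S x - sandwichKernel r S x') ⊤ G.vol ≤
      ENNReal.ofReal (C * (‖S‖ * C) * G.d x x') := by
  rw [sandwichKernel_sub_eq_conj hS,
    show eLpNorm (fun y => conj ⟪r y, S (r x - r x')⟫_ℂ) ⊤ G.vol = _ from eLpNorm_conj _ ⊤ G.vol]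
  refine eLpNormEssSup_le_of_ae_bound (ae_of_all _ fun y => ?_) |>.trans' (by
    rw [eLpNorm_exponent_top])
  refine (norm_inner_le_norm _ _).trans ?_
  rw [mul_assoc]
  exact mul_le_mul (h.norm_le y) (h.norm_apply_sub_le S x x') (norm_nonneg _) h.pos.le

theorem memLp_sandwichKernel (h : G.IsResolventKernel D R r C) (hS : IsSelfAdjoint S)
    (x : G.Point) : MemLp (sandwichKernel r S x) 2 G.vol ∧ MemLp (sandwichKernel r S x) ⊤ G.vol := by
  obtain ⟨g, hg, -, -⟩ := h.exists_deriv (S (r x))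
  rw [sandwichKernel_eq_conj hS]
  refine ⟨hg.memLp.star, memLp_top_of_bound hg.memLp.star.1 (C * ‖S (r x)‖)
    (ae_of_all _ fun y => ?_)⟩
  rw [RCLike.norm_conj]
  exact (norm_inner_le_norm _ _).trans (mul_le_mul_of_nonneg_right (h.norm_le y) (norm_nonneg _))

theorem memW22_sandwichKernel (h : G.IsResolventKernel D R r C) (hS : IsSelfAdjoint S)
    (x : G.Point) : G.MemW22 (sandwichKernel r S x) ∧
      ∃ f', G.MemW12 (sandwichKernel r S x) f' := by
  obtain ⟨g, hg, hgw, -⟩ := h.exists_deriv (S (r x))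
  rw [sandwichKernel_eq_conj hS]
  exact ⟨⟨_, _, hg.isWeakDeriv.star, hgw.star, hg.memLp.star, hg.memLp_deriv.star,
    (Lp.memLp (R (S (r x)) - S (r x))).star⟩, _, hg.star.toMemW12⟩

theorem w22Norm_sub_le (h : G.IsResolventKernel D R r C) (hS : IsSelfAdjoint S) (x x' : G.Point) :
    G.w22Norm (sandwichKernel r S x - sandwichKernel r S x') ≤
      ENNReal.ofReal (‖S‖ * C * G.d x x') := by
  rw [sandwichKernel_sub_eq_conj hS]
  exact (h.w22Norm_conj_inner_le _).trans
    (ENNReal.ofReal_le_ofReal (h.norm_apply_sub_le S x x'))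

theorem integral_sandwichKernel_mul (h : G.IsResolventKernel D R r C) (hS : IsSelfAdjoint S)
    (x : G.Point) (u : G.L2) : Integrable (fun y => sandwichKernel r S x y * u y) G.vol ∧
      ∫ y, sandwichKernel r S x y * u y ∂G.vol = ⟪r x, S (R u)⟫_ℂ := by
  have e : (fun y => ⟪R (S (r x)) y, u y⟫_ℂ) =ᵐ[G.vol]
      fun y => sandwichKernel r S x y * u y := by
    filter_upwards [h.ae_eq (S (r x))] with y hy
    simp only [sandwichKernel_eq_conj hS]
    rw [hy, RCLike.inner_apply, mul_comm]
  refine ⟨(L2.integrable_inner (R (S (r x))) u).congr e, ?_⟩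
  rw [← integral_congr_ae e, ← L2.inner_def, ← ContinuousLinearMap.adjoint_inner_right,
    ContinuousLinearMap.isSelfAdjoint_iff'.1 h.isSelfAdjoint,
    ← ContinuousLinearMap.adjoint_inner_right, ContinuousLinearMap.isSelfAdjoint_iff'.1 hS]

end IsResolventKernel

end MetricGraph

namespace MetricGraph

variable {V E : Type*} {G : MetricGraph V E} {D : Set V}

/-! ### The heat kernel -/

namespace IsResolventKernel

variable {R : G.L2 →L[ℂ] G.L2} {r : G.Point → G.L2} {C : ℝ}

/-- Since `exp (t Δ) = R ((1 - Δ)² exp (t Δ)) R`, the heat kernel is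
`p_t(x, y) = ⟪r x, (1 - Δ)² exp (t Δ) (r y)⟫`. -/
theorem isHeatKernel (h : G.IsResolventKernel D R r C) (hconn : G.IsConnected)
    (hfin : G.LocallyFinite) :
    G.IsHeatKernel D (fun t => sandwichKernel r (heatPower R 2 t)) := by
  have := countable_vertices hconn hfin
  have := countable_edges hconn hfin
  have := secondCountableTopology_point (G := G)
  have hsa := h.isSelfAdjoint
  refine ⟨fun t _ => (h.continuous_uncurry hconn _).measurable,
    ⟨heatSemigroup R, h.isHeatSemigroup, fun t ht u => ?_⟩, ae_of_all _ fun y => ?_,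
    fun s t hs ht => ae_of_all _ fun z => ?_⟩
  · have e : heatSemigroup R t u = R (heatPower R 2 t (R u)) := by
      have : heatPower R 0 t = R * (heatPower R 2 t * R) := by
        rw [heatPower_succ_mul hsa 1 ht, mul_heatPower_succ hsa 0 ht]
      rw [heatSemigroup_of_pos ht, this]
      rfl
    rw [e]
    filter_upwards [h.ae_eq (heatPower R 2 t (R u))] with x hx
    obtain ⟨h1, h2⟩ := h.integral_sandwichKernel_mul (isSelfAdjoint_heatPower 2 t) x u
    exact ⟨h1, by rw [h2, ← hx]⟩
  · have hR1 : ∀ t, 0 < t → R (heatPower R 2 t (r y)) = heatPower R 1 t (r y) := fun t ht =>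
      congrArg (fun T : G.L2 →L[ℂ] G.L2 => T (r y)) (mul_heatPower_succ hsa 1 ht)
    have hder : ∀ n t, 0 < t → HasDerivAt (fun t => heatPower R n t (r y))
        (heatPower R n t (r y) - heatPower R (n + 1) t (r y)) t := by
      intro n t ht
      have h1 := (hasDerivAt_heatPower h.isPositive h.norm_le_one n ht)
      exact (((ContinuousLinearMap.apply ℂ G.L2 (r y)).restrictScalars ℝ).hasFDerivAt.comp_hasDerivAt
        t h1)
    refine ⟨fun t => heatPower R 1 t (r y), fun t => heatPower R 1 t (r y) - heatPower R 2 t (r y),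
      fun t ht => ?_, fun t ht => ?_, fun t ht => ?_, hder 1⟩
    · have := h.ae_eq (heatPower R 2 t (r y))
      rwa [hR1 t ht] at this
    · rw [h.isLaplacian_iff, sub_sub_cancel, hR1 t ht]
    · exact ((hder 1 t ht).continuousAt.sub (hder 2 t ht).continuousAt).continuousWithinAt
  · have hae := h.ae_eq (heatPower R 2 s (r z.2))
    obtain ⟨h1, h2⟩ := h.integral_sandwichKernel_mul (isSelfAdjoint_heatPower 2 t) z.1
      (R (heatPower R 2 s (r z.2)))
    have e : (fun y => sandwichKernel r (heatPower R 2 t) z.1 y *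
        R (heatPower R 2 s (r z.2)) y) =ᵐ[G.vol] fun y =>
        sandwichKernel r (heatPower R 2 t) z.1 y * sandwichKernel r (heatPower R 2 s) y z.2 := by
      filter_upwards [hae] with y hy
      rw [← hy, sandwichKernel, sandwichKernel]
    refine ⟨h1.congr e, ?_⟩
    rw [← integral_congr_ae e, h2, sandwichKernel]
    have e2 : heatPower R 2 (t + s) = heatPower R 2 t * (R * (R * heatPower R 2 s)) := by
      rw [mul_heatPower_succ hsa 1 hs, mul_heatPower_succ hsa 0 hs, heatPower_mul 2 0 ht hs]
    rw [e2]
    rfl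

theorem heatKernel_unique (h : G.IsResolventKernel D R r C) (hconn : G.IsConnected)
    (hfin : G.LocallyFinite) {p q : ℝ → G.Point → G.Point → ℂ} (hp : G.IsHeatKernel D p)
    (hq : G.IsHeatKernel D q) {t : ℝ} (ht : 0 < t) :
    Function.uncurry (q t) =ᵐ[G.vol.prod G.vol] Function.uncurry (p t) := by
  have := countable_vertices hconn hfin
  have := countable_edges hconn hfin
  have := secondCountableTopology_point (G := G)
  have : SigmaFinite G.vol := sigmaFinite_vol
  obtain ⟨T, hT, hTp⟩ := hp.kernel
  obtain ⟨T', hT', hTq⟩ := hq.kernel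
  have hTT' : T' t = T t := (h.eq_heatSemigroup hT' ht.le).trans (h.eq_heatSemigroup hT ht.le).symm
  refine ae_eq_of_integral_kernel_eq (hq.measurable t ht) (hp.measurable t ht) fun u => ?_
  have h1 := hTq t ht u
  rw [hTT'] at h1
  filter_upwards [h1, hTp t ht u] with x hx hx'
  exact ⟨hx.1, hx'.1, hx.2.symm.trans hx'.2⟩

end IsResolventKernel

end MetricGraph

theorem mainTheorem7 {V E : Type*} (G : MetricGraph V E)
    (hconn : G.IsConnected) (hfin : G.LocallyFinite) (hlen : G.LengthsBoundedBelow)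
    (D : Set V) :
    ∃ p : ℝ → G.Point → G.Point → ℂ,
      -- `p` is the heat kernel, which is unique up to null sets
      G.IsHeatKernel D p ∧
      (∀ q : ℝ → G.Point → G.Point → ℂ, G.IsHeatKernel D q →
        ∀ t, 0 < t → Function.uncurry (q t) =ᵐ[G.vol.prod G.vol] Function.uncurry (p t)) ∧
      -- Lipschitz continuity of `x ↦ Δ_y p_t(x, ·)` in `L²` and `L^∞`
      (∀ t, 0 < t → ∃ w : G.Point → G.Point → ℂ,
        (∀ x, G.IsLaplacian D (p t x) (w x) ∧ MemLp (w x) 2 G.vol ∧ MemLp (w x) ∞ G.vol) ∧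
        (∃ L : ℝ, ∀ x x',
          eLpNorm (w x - w x') 2 G.vol ≤ ENNReal.ofReal (L * G.d x x')) ∧
        (∃ L : ℝ, ∀ x x',
          eLpNorm (w x - w x') ∞ G.vol ≤ ENNReal.ofReal (L * G.d x x'))) ∧
      -- joint Lipschitz continuity of `p_t` and of `∂²/∂x² ∂²/∂y² p_t`
      (∀ t, 0 < t → G.JointlyLipschitz (p t)) ∧
      (∀ t, 0 < t → ∃ q : G.Point → G.Point → ℂ,
        G.IsMixedSecondDeriv (p t) q ∧ G.JointlyLipschitz q) ∧
      -- Lipschitz continuity of `x ↦ p_t(x, ·)` in `W^{2,2}`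
      (∀ t, 0 < t → ∀ x, G.MemW22 (p t x) ∧ ∃ f' : G.Point → ℂ, G.MemW12 (p t x) f') ∧
      (∃ C₁ C₂ : ℝ, 0 < C₁ ∧ 0 < C₂ ∧ ∀ t, 0 < t → ∀ x x',
        G.w22Norm (p t x - p t x') ≤
          ENNReal.ofReal ((C₁ + C₂ * t ^ (-2 : ℤ)) * G.d x x')) := by
  obtain ⟨R, r, C, h⟩ := MetricGraph.exists_isResolventKernel hconn hfin hlen D
  have hsa := h.isSelfAdjoint
  have hB : ∀ n t, IsSelfAdjoint (heatPower R n t) := isSelfAdjoint_heatPower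
  -- the operators of the kernels `Δ_y p_t` and `Δ_x Δ_y p_t`
  set S₁ : ℝ → G.L2 →L[ℂ] G.L2 := fun t => heatPower R 2 t - heatPower R 3 t with hS₁
  set S₂ : ℝ → G.L2 →L[ℂ] G.L2 := fun t =>
    (heatPower R 2 t - heatPower R 3 t) - (heatPower R 3 t - heatPower R 4 t) with hS₂
  have hsa₁ : ∀ t, IsSelfAdjoint (S₁ t) := fun t => (hB 2 t).sub (hB 3 t)
  have hRS : ∀ t, 0 < t → R * heatPower R 2 t - heatPower R 2 t = R * S₁ t := by
    intro t ht
    rw [hS₁, mul_sub, mul_heatPower_succ hsa 2 ht]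
  have hRS₁ : ∀ t, 0 < t → R * S₁ t - S₁ t = R * S₂ t := by
    intro t ht
    simp only [hS₁, hS₂, mul_sub, mul_heatPower_succ hsa 2 ht, mul_heatPower_succ hsa 3 ht,
      mul_heatPower_succ hsa 1 ht]
  refine ⟨fun t => MetricGraph.sandwichKernel r (heatPower R 2 t), h.isHeatKernel hconn hfin,
    fun q hq t ht => h.heatKernel_unique hconn hfin (h.isHeatKernel hconn hfin) hq ht,
    fun t ht => ⟨MetricGraph.sandwichKernel r (S₁ t), fun x =>
      ⟨h.isLaplacian_sandwichKernel (hB 2 t) (hsa₁ t) (hRS t ht) x,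
        h.memLp_sandwichKernel (hsa₁ t) x⟩,
      ⟨_, h.eLpNorm_two_sub_le (hsa₁ t)⟩, ⟨_, h.eLpNorm_top_sub_le (hsa₁ t)⟩⟩,
    fun t _ => h.jointlyLipschitz _,
    fun t ht => ⟨MetricGraph.sandwichKernel r (S₂ t), ?_, h.jointlyLipschitz _⟩,
    fun t _ x => h.memW22_sandwichKernel (hB 2 t) x,
    2 * C, 4 * C, mul_pos two_pos h.pos, mul_pos four_pos h.pos, fun t ht x x' => ?_⟩
  · choose k₁ hk₁ hk₁' using fun x =>
      h.exists_hasEdgeDeriv_right hlen (hB 2 t) (hsa₁ t) (hRS t ht) x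
    choose k₃ hk₃ hk₃' using fun y => h.exists_hasEdgeDeriv_left hlen (hRS₁ t ht) y
    exact ⟨k₁, MetricGraph.sandwichKernel r (S₁ t), fun x y => k₃ y x, hk₁, hk₁',
      fun e s _ => ⟨hk₃ (G.pt e s), hk₃' (G.pt e s)⟩⟩
  · refine (h.w22Norm_sub_le (hB 2 t) x x').trans (ENNReal.ofReal_le_ofReal ?_)
    refine mul_le_mul_of_nonneg_right ?_ (MetricGraph.d_nonneg x x')
    have := mul_le_mul_of_nonneg_right (norm_heatPower_two_le h.isPositive h.norm_le_one ht)
      h.pos.le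
    linarith
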